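/- Let $\mathbb{C}^2$ carry its standard Hermitian scalar product and the induced structure of a Euclidean space $\mathbb{R}^4$. For a convex compact set $K\subset\mathbb{C}^2$ put $$\phi(K)=\int_{\mathbb{CP}^1}\mathrm{vol}_2(\mathrm{Pr}_\xi K)\,d\xi,\qquad \psi(K)=\int_{LGr_2}\mathrm{vol}_2(\mathrm{Pr}_F K)\,dF,$$ where $\mathbb{CP}^1$ is the space of complex lines $\xi\subset\mathbb{C}^2$ through the origin, $LGr_2$ is the Grassmannian of Lagrangian linear planes $F\subset\mathbb{C}^2$ (real planes on which $\mathrm{Im}\langle x,y\rangle$ vanishes), $d\xi$ and $dF$ are the $U(2)$-invariant (Haar) measures on these spaces of total mass $1$, $\mathrm{Pr}_E$ is the orthogonal projection onto $E$, and $\mathrm{vol}_2$ is the area in the plane $E$. Let $V_2$ be the second intrinsic volume on $\mathbb{R}^4$, that is, the quantity $V_2(K)$ in the Steiner formula $$\mathrm{vol}_4(K+\varepsilon D)=\sum_{j=0}^{4}\kappa_{4-j}\,V_j(K)\,\varepsilon^{4-j}\qquad(\varepsilon\ge 0),$$ where $D$ is the unit ball of $\mathbb{R}^4$ and $\kappa_m$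 is the volume of the unit ball of $\mathbb{R}^m$; in particular $V_2$ is the area on sets contained in a plane. Then, for every convex compact set $K\subset\mathbb{C}^2$, $$\phi(K)+2\,\psi(K)=V_2(K).$$ -/

import Mathlib

open MeasureTheory
open scoped Pointwise

noncomputable section

namespace HermitianPlane

/-- The Hermitian plane `ℂ²`; as a real Euclidean space it is `ℝ⁴`. -/
abbrev C2 : Type := EuclideanSpace ℂ (Fin 2)

/-! ### Intrinsic volumes -/

/-- The volume `κ_m` of the unit ball of `ℝ^m`. -/
def unitBallVolume (m : ℕ) : ℝ :=
  (volume : Measure (EuclideanSpace ℝ (Fin m))).real (Metric.closedBall 0 1)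

section IntrinsicVolume

variable {V : Type*} [NormedAddCommGroup V] [InnerProductSpace ℝ V] [FiniteDimensional ℝ V]
  [MeasurableSpace V] [BorelSpace V]

/-- `v 0, …, v n` (with `n = dim V`) are the coefficients of the Steiner polynomial of `K`:
`vol (K + ε D) = ∑ j, κ_{n-j} * v j * ε^{n-j}` for all `ε ≥ 0`, where `D` is the unit ball.
The sequence is extended by zero beyond `n`, so it is determined by `K`. -/
def IsSteinerSequence (K : Set V) (v : ℕ → ℝ) : Prop :=
  (∀ j, Module.finrank ℝ V < j → v j = 0) ∧
  ∀ ε : ℝ, 0 ≤ ε →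
    (volume : Measure V).real (K + ε • Metric.closedBall (0 : V) 1) =
      ∑ j ∈ Finset.range (Module.finrank ℝ V + 1),
        unitBallVolume (Module.finrank ℝ V - j) * v j * ε ^ (Module.finrank ℝ V - j)

open Classical in
/-- The `j`-th intrinsic volume `V_j(K)` of a convex compact set `K` in a Euclidean space, defined
by the Steiner formula. -/
def intrinsicVolume (j : ℕ) (K : Set V) : ℝ :=
  if h : ∃ v, IsSteinerSequence K v then h.choose j else 0

/-- The area `vol₂(Pr_F K)` of the orthogonal projection of `K` to a plane `F`, measured by the
Lebesgue measure of the Euclidean space `F`. -/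
def projectionArea (K : Set V) (F : Submodule ℝ V) : ℝ :=
  (volume : Measure F).real (F.orthogonalProjectionOnto '' K)

/-- The usual topology of the Grassmannian: that of the orthogonal projections in `End V`. -/
abbrev grassmannTopology : TopologicalSpace (Submodule ℝ V) :=
  TopologicalSpace.induced (fun F : Submodule ℝ V => (F.starProjection : V →L[ℝ] V)) inferInstance

end IntrinsicVolume

/-! ### The unitary group and its Haar probability measure -/

/-- The unitary group `U(2)`. -/
abbrev U2 : Type := Matrix.unitaryGroup (Fin 2) ℂ

lemma isCompact_unitary :
    IsCompact (Matrix.unitaryGroup (Fin 2) ℂ : Set (Matrix (Fin 2) (Fin 2) ℂ)) := by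
  refine IsCompact.of_isClosed_subset
    (isCompact_univ_pi fun _ : Fin 2 => isCompact_univ_pi fun _ : Fin 2 =>
      isCompact_closedBall (0 : ℂ) 1) isClosed_unitary ?_
  intro g hg i _ j _
  simpa using entry_norm_bound_of_unitary hg i j

instance : CompactSpace U2 := isCompact_iff_compactSpace.mp isCompact_unitary

instance : MeasurableSpace U2 := borel U2
instance : BorelSpace U2 := ⟨rfl⟩

/-- The Haar measure of `U(2)` with total mass one. -/
def haarU2 : Measure U2 := Measure.haarMeasure ⊤

/-- The action of a unitary matrix on `ℂ²`, as a real linear map. -/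
def act (g : U2) : C2 →ₗ[ℝ] C2 := (Matrix.toEuclideanLin g.1).restrictScalars ℝ

lemma act_apply (g : U2) (x : C2) : act g x = Matrix.toEuclideanLin g.1 x := rfl

lemma act_smul (g : U2) (c : ℂ) (x : C2) : act g (c • x) = c • act g x := by
  simp [act_apply]

lemma act_mul (g h : U2) (x : C2) : act (g * h) x = act g (act h x) := by
  ext i
  simp [act_apply, Matrix.toLpLin_apply]

lemma act_one (x : C2) : act 1 x = x := by
  ext i
  simp [act_apply]

lemma inner_act (g : U2) (x y : C2) : inner ℂ (act g x) (act g y) = inner ℂ x y := by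
  have h := Matrix.mem_unitaryGroup_iff'.mp g.2
  have h' : Matrix.toEuclideanLin (Matrix.conjTranspose g.1) (Matrix.toEuclideanLin g.1 y) = y := by
    rw [Matrix.star_eq_conjTranspose] at h
    ext i
    rw [Matrix.toLpLin_apply, Matrix.toLpLin_apply, WithLp.ofLp_toLp, Matrix.mulVec_mulVec, h,
      Matrix.one_mulVec]
  rw [act_apply, act_apply, ← LinearMap.adjoint_inner_right,
    ← Matrix.toEuclideanLin_conjTranspose_eq_adjoint, h']

lemma inner_real_eq (x y : C2) : inner ℝ x y = (inner ℂ x y : ℂ).re := by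
  simp [PiLp.inner_apply, Complex.inner]

lemma act_injective (g : U2) : Function.Injective (act g) := by
  intro x y h
  have := congrArg (act g⁻¹) h
  simpa [← act_mul, act_one] using this

lemma finrank_map_act (g : U2) (F : Submodule ℝ C2) :
    Module.finrank ℝ (F.map (act g)) = Module.finrank ℝ F :=
  (Submodule.equivMapOfInjective (act g) (act_injective g) F).finrank_eq.symm

lemma starProjection_map_act (g : U2) (F : Submodule ℝ C2) (x : C2) :
    (F.map (act g)).starProjection x = act g (F.starProjection (act g⁻¹ x)) := by
  have hx : x = act g (act g⁻¹ x) := by simp [← act_mul, act_one]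
  refine Submodule.eq_starProjection_of_mem_of_inner_eq_zero
    (Submodule.mem_map_of_mem (Submodule.starProjection_apply_mem _ _)) ?_
  rintro _ ⟨y, hy, rfl⟩
  nth_rewrite 1 [hx]
  rw [← map_sub, inner_real_eq, inner_act, ← inner_real_eq]
  exact Submodule.starProjection_inner_eq_zero _ _ hy

lemma continuous_act : Continuous fun p : U2 × C2 => act p.1 p.2 := by
  have h : Continuous fun p : U2 × C2 => p.1.1.mulVec p.2.ofLp :=
    (continuous_subtype_val.comp continuous_fst).matrix_mulVec
      ((PiLp.continuous_ofLp 2 _).comp continuous_snd)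
  exact (PiLp.continuous_toLp 2 _).comp h

/-! ### Complex lines and Lagrangian planes -/

/-- `F` is a complex line of `ℂ²`: a real plane stable under multiplication by `i`. -/
def IsComplexLine (F : Submodule ℝ C2) : Prop :=
  Module.finrank ℝ F = 2 ∧ ∀ x ∈ F, Complex.I • x ∈ F

/-- `F` is a (linear) Lagrangian plane of `ℂ²`: a real plane on which the symplectic form
`Im ⟨x, y⟩` vanishes. -/
def IsLagrangian (F : Submodule ℝ C2) : Prop :=
  Module.finrank ℝ F = 2 ∧ ∀ x ∈ F, ∀ y ∈ F, (inner ℂ x y : ℂ).im = 0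

/-- The space `ℂP¹` of complex lines in `ℂ²`. -/
def ComplexLine : Type := {F : Submodule ℝ C2 // IsComplexLine F}

/-- The Lagrangian Grassmannian `LGr₂` of `ℂ²`. -/
def LagrangianPlane : Type := {F : Submodule ℝ C2 // IsLagrangian F}

instance : TopologicalSpace ComplexLine := grassmannTopology.induced Subtype.val
instance : MeasurableSpace ComplexLine := borel ComplexLine
instance : BorelSpace ComplexLine := ⟨rfl⟩

instance : TopologicalSpace LagrangianPlane := grassmannTopology.induced Subtype.val
instance : MeasurableSpace LagrangianPlane := borel LagrangianPlane
instance : BorelSpace LagrangianPlane := ⟨rfl⟩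

/-- The action of `U(2)` on complex lines. -/
def ComplexLine.move (g : U2) (F : ComplexLine) : ComplexLine :=
  ⟨F.1.map (act g), by
    refine ⟨(finrank_map_act g F.1).trans F.2.1, ?_⟩
    rintro _ ⟨x, hx, rfl⟩
    exact ⟨Complex.I • x, F.2.2 x hx, act_smul g _ x⟩⟩

/-- The action of `U(2)` on Lagrangian planes. -/
def LagrangianPlane.move (g : U2) (F : LagrangianPlane) : LagrangianPlane :=
  ⟨F.1.map (act g), by
    refine ⟨(finrank_map_act g F.1).trans F.2.1, ?_⟩
    rintro _ ⟨x, hx, rfl⟩ _ ⟨y, hy, rfl⟩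
    rw [inner_act]
    exact F.2.2 x hx y hy⟩

lemma finrank_span_pair {u v : C2} (h : LinearIndependent ℝ ![u, v]) :
    Module.finrank ℝ (Submodule.span ℝ {u, v}) = 2 := by
  have := finrank_span_eq_card h
  rwa [Matrix.range_cons, Matrix.range_cons, Matrix.range_empty, Set.union_empty,
    Set.singleton_union, Fintype.card_fin] at this

/-- The complex line `ℂ × 0`. -/
def ComplexLine.base : ComplexLine :=
  ⟨Submodule.span ℝ {!₂[1, 0], !₂[Complex.I, 0]}, by
    refine ⟨finrank_span_pair ?_, ?_⟩
    · rw [LinearIndependent.pair_iff]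
      intro s t h
      have h0 := congrArg (fun z : C2 => z 0) h
      have h1 := congrArg Complex.re h0
      have h2 := congrArg Complex.im h0
      simp at h1 h2
      exact ⟨h1, h2⟩
    · intro x hx
      obtain ⟨s, t, rfl⟩ := Submodule.mem_span_pair.mp hx
      refine Submodule.mem_span_pair.mpr ⟨-t, s, ?_⟩
      ext i
      fin_cases i <;> apply Complex.ext <;> simp⟩

/-- The Lagrangian plane `ℝ²`. -/
def LagrangianPlane.base : LagrangianPlane :=
  ⟨Submodule.span ℝ {!₂[1, 0], !₂[0, 1]}, by
    refine ⟨finrank_span_pair ?_, ?_⟩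
    · rw [LinearIndependent.pair_iff]
      intro s t h
      have h0 := congrArg (fun z : C2 => (z 0).re) h
      have h1 := congrArg (fun z : C2 => (z 1).re) h
      simp at h0 h1
      exact ⟨h0, h1⟩
    · intro x hx y hy
      obtain ⟨s, t, rfl⟩ := Submodule.mem_span_pair.mp hx
      obtain ⟨s', t', rfl⟩ := Submodule.mem_span_pair.mp hy
      rw [PiLp.inner_apply]
      simp⟩

lemma continuous_map_act (F : Submodule ℝ C2) :
    @Continuous _ _ _ grassmannTopology fun g : U2 => F.map (act g) := by
  have h1 (x : C2) : Continuous fun g : U2 => act g⁻¹ x :=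
    continuous_act.comp (f := fun g : U2 => (g⁻¹, x)) (by fun_prop)
  have h (x : C2) : Continuous fun g : U2 => (g, F.starProjection (act g⁻¹ x)) :=
    Continuous.prodMk continuous_id (F.starProjection.continuous.comp (h1 x))
  have h' : Continuous fun g : U2 => ((F.map (act g)).starProjection : C2 →L[ℝ] C2) := by
    refine continuous_clm_apply.mpr fun x => ?_
    exact (continuous_act.comp (h x)).congr fun g => (starProjection_map_act g F x).symm
  exact continuous_induced_rng.mpr h'

lemma ComplexLine.continuous_move (F : ComplexLine) : Continuous fun g : U2 => F.move g :=
  continuous_induced_rng.mpr (continuous_map_act F.1)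

lemma LagrangianPlane.continuous_move (F : LagrangianPlane) : Continuous fun g : U2 => F.move g :=
  continuous_induced_rng.mpr (continuous_map_act F.1)

/-- The Haar measure of `ℂP¹` with total mass one: the image of the Haar measure of `U(2)`. -/
def haarComplexLine : Measure ComplexLine := haarU2.map fun g => ComplexLine.base.move g

/-- The Haar measure of `LGr₂` with total mass one: the image of the Haar measure of `U(2)`. -/
def haarLagrangian : Measure LagrangianPlane := haarU2.map fun g => LagrangianPlane.base.move g

instance : IsProbabilityMeasure haarU2 :=
  ⟨Measure.haarMeasure_self (K₀ := (⊤ : TopologicalSpace.PositiveCompacts U2))⟩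

instance : IsProbabilityMeasure haarComplexLine :=
  Measure.isProbabilityMeasure_map (ComplexLine.continuous_move _).measurable.aemeasurable

instance : IsProbabilityMeasure haarLagrangian :=
  Measure.isProbabilityMeasure_map (LagrangianPlane.continuous_move _).measurable.aemeasurable

/-! The two measures are the Haar measures: they are `U(2)`-invariant, and `U(2)` acts
transitively on `ℂP¹` and on `LGr₂`. -/

lemma span_pair_eq {F : Submodule ℝ C2} (hF : Module.finrank ℝ F = 2) {u v : C2} (hu : u ∈ F) (hv : v ∈ F)
  (h : LinearIndependent ℝ ![u,v]) : Submodule.span ℝ {u,v} = F := by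
  refine Submodule.eq_of_le_of_finrank_eq ?_ ((finrank_span_pair h).trans hF.symm)
  rw [Submodule.span_le]
  rintro x (rfl | rfl) <;> assumption

lemma exists_orthonormal_pair {F : Submodule ℝ C2} (hF : Module.finrank ℝ F = 2) : ∃ u v : C2, u ∈ F ∧ v ∈ F ∧
   inner ℝ u u = (1:ℝ) ∧ inner ℝ v v = (1:ℝ) ∧ inner ℝ u v = (0:ℝ) ∧ Submodule.span ℝ {u,v} = F := by
  let b := stdOrthonormalBasis ℝ F
  have e : Fin 2 ≃ Fin (Module.finrank ℝ F) := finCongr hF.symm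
  have hb := (b.reindex e.symm).orthonormal
  have ho : Orthonormal ℝ ![(((b.reindex e.symm) 0 : F) : C2), ((b.reindex e.symm) 1 : F)] := by
    have := hb.comp_linearIsometry F.subtypeₗᵢ
    convert this using 1
    ext i; fin_cases i <;> rfl
  refine ⟨_, _, Subtype.coe_prop _, Subtype.coe_prop _, ?_, ?_, ?_, span_pair_eq hF (Subtype.coe_prop _) (Subtype.coe_prop _) ho.linearIndependent⟩
  · simpa using orthonormal_iff_ite.mp ho 0 0
  · simpa using orthonormal_iff_ite.mp ho 1 1
  · simpa using orthonormal_iff_ite.mp ho 0 1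

/-- `U(2)` acts transitively on Lagrangian planes. -/
lemma LagrangianPlane.exists_move_base (F : LagrangianPlane) : ∃ g, LagrangianPlane.base.move g = F := by
  obtain ⟨u, v, hu, hv, huu, hvv, huv, hs⟩ := exists_orthonormal_pair F.2.1
  have h1 := F.2.2 u hu v hv
  have c1 : inner ℂ u u = (1:ℂ) := Complex.ext (by rw [← inner_real_eq, huu]; rfl) (F.2.2 u hu u hu)
  have c2 : inner ℂ v v = (1:ℂ) := Complex.ext (by rw [← inner_real_eq, hvv]; rfl) (F.2.2 v hv v hv)
  have c3 : inner ℂ u v = (0:ℂ) := Complex.ext (by rw [← inner_real_eq, huv]; rfl) h1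
  have c4 : inner ℂ v u = (0:ℂ) := by rw [← inner_conj_symm, c3]; simp
  rw [PiLp.inner_apply, Fin.sum_univ_two] at c1 c2 c3 c4
  simp only [RCLike.inner_apply] at c1 c2 c3 c4
  let M : Matrix (Fin 2) (Fin 2) ℂ := !![u 0, v 0; u 1, v 1]
  have hM : M ∈ Matrix.unitaryGroup (Fin 2) ℂ := by
    rw [Matrix.mem_unitaryGroup_iff']
    ext i j
    fin_cases i <;> fin_cases j <;> simp [M, Matrix.mul_apply, Fin.sum_univ_two] <;>
      simp only [mul_comm ] at * <;> assumption
  refine ⟨⟨M, hM⟩, Subtype.ext ?_⟩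
  change (Submodule.span ℝ {_, _}).map _ = F.1
  rw [Submodule.map_span, Set.image_pair, ← hs]
  congr 3
  · ext i; fin_cases i <;> simp [act_apply, M, Matrix.toLpLin_apply]
  · ext i; fin_cases i <;> simp [act_apply, M, Matrix.toLpLin_apply]

/-- `U(2)` acts transitively on complex lines. -/
lemma ComplexLine.exists_move_base (F : ComplexLine) : ∃ g, ComplexLine.base.move g = F := by
  obtain ⟨u, v, hu, hv, huu, hvv, huv, hs⟩ := exists_orthonormal_pair F.2.1
  have hI := F.2.2 u hu
  have c1 : inner ℂ u u = (1:ℂ) := by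
    refine Complex.ext (by rw [← inner_real_eq, huu]; rfl) ?_
    exact Complex.conj_eq_iff_im.mp (inner_conj_symm (𝕜 := ℂ) u u)
  have hu0 : u ≠ 0 := by rintro rfl; simp at huu
  have hs' : Submodule.span ℝ {u, Complex.I • u} = F.1 := by
    refine span_pair_eq F.2.1 hu hI ?_
    rw [LinearIndependent.pair_iff]
    intro s t h
    have : ((s : ℂ) + t * Complex.I) • u = 0 := by
      rw [add_smul, mul_smul]; simpa using h
    have := (smul_eq_zero.mp this).resolve_right hu0
    have h1 := congrArg Complex.re this
    have h2 := congrArg Complex.im this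
    simp at h1 h2
    exact ⟨h1, h2⟩
  rw [PiLp.inner_apply, Fin.sum_univ_two] at c1
  simp only [RCLike.inner_apply] at c1
  let M : Matrix (Fin 2) (Fin 2) ℂ := !![u 0, - (starRingEnd ℂ) (u 1); u 1, (starRingEnd ℂ) (u 0)]
  have hM : M ∈ Matrix.unitaryGroup (Fin 2) ℂ := by
    rw [Matrix.mem_unitaryGroup_iff']
    ext i j
    fin_cases i <;> fin_cases j <;> simp [M, Matrix.mul_apply, Fin.sum_univ_two] <;> first | linear_combination c1 | ring
  refine ⟨⟨M, hM⟩, Subtype.ext ?_⟩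
  change (Submodule.span ℝ {_, _}).map _ = F.1
  rw [Submodule.map_span, Set.image_pair, ← hs']
  congr 3
  · ext i; fin_cases i <;> simp [act_apply, M, Matrix.toLpLin_apply]
  · ext i; fin_cases i <;> simp [act_apply, M, Matrix.toLpLin_apply]

lemma continuous_map_act_right (g : U2) : @Continuous _ _ grassmannTopology grassmannTopology fun F : Submodule ℝ C2 => F.map (act g) := by
  let := grassmannTopology (V := C2)
  have h0 : Continuous fun F : Submodule ℝ C2 => (F.starProjection : C2 →L[ℝ] C2) := continuous_induced_dom
  have h' : Continuous fun F : Submodule ℝ C2 => ((F.map (act g)).starProjection : C2 →L[ℝ] C2) := by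
    refine continuous_clm_apply.mpr fun x => ?_
    have h1 : Continuous fun F : Submodule ℝ C2 => F.starProjection (act g⁻¹ x) :=
      (continuous_clm_apply.mp h0) _
    exact (continuous_act.comp (f := fun F : Submodule ℝ C2 => (g, F.starProjection (act g⁻¹ x)))
      (Continuous.prodMk continuous_const h1)).congr fun F => (starProjection_map_act g F x).symm
  exact continuous_induced_rng.mpr h'

/-- The measure is invariant under `U(2)`. -/
lemma map_move_haarComplexLine (g : U2) : haarComplexLine.map (ComplexLine.move g) = haarComplexLine := by
  let := grassmannTopology (V := C2)
  have hc : Continuous (ComplexLine.move g) :=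
    continuous_induced_rng.mpr ((continuous_map_act_right g).comp continuous_induced_dom)
  rw [haarComplexLine, Measure.map_map hc.measurable (ComplexLine.continuous_move _).measurable]
  have : Measure.map (fun h => g * h) haarU2 = haarU2 := by
    rw [haarU2]; exact map_mul_left_eq_self _ g
  conv_rhs => rw [← this, Measure.map_map (ComplexLine.continuous_move _).measurable (by
    exact (continuous_const_mul g).measurable)]
  congr 1
  ext h : 1
  refine Subtype.ext ?_
  simp only [Function.comp, ComplexLine.move, ← Submodule.map_comp]
  congr 1
  ext x : 1
  exact (act_mul g h x).symm

/-- The measure is invariant under `U(2)`. -/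
lemma map_move_haarLagrangian (g : U2) : haarLagrangian.map (LagrangianPlane.move g) = haarLagrangian := by
  let := grassmannTopology (V := C2)
  have hc : Continuous (LagrangianPlane.move g) :=
    continuous_induced_rng.mpr ((continuous_map_act_right g).comp continuous_induced_dom)
  rw [haarLagrangian, Measure.map_map hc.measurable (LagrangianPlane.continuous_move _).measurable]
  have : Measure.map (fun h => g * h) haarU2 = haarU2 := by
    rw [haarU2]; exact map_mul_left_eq_self _ g
  conv_rhs => rw [← this, Measure.map_map (LagrangianPlane.continuous_move _).measurable (by
    exact (continuous_const_mul g).measurable)]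
  congr 1
  ext h : 1
  refine Subtype.ext ?_
  simp only [Function.comp, LagrangianPlane.move, ← Submodule.map_comp]
  congr 1
  ext x : 1
  exact (act_mul g h x).symm

/-! ### The two averages -/

/-- `φ(K)`: the average of the area of the projections of `K` to the complex lines of `ℂ²`. -/
def complexAverage (K : Set C2) : ℝ := ∫ F : ComplexLine, projectionArea K F.1 ∂haarComplexLine

/-- `ψ(K)`: the average of the area of the projections of `K` to the Lagrangian planes of `ℂ²`. -/
def lagrangianAverage (K : Set C2) : ℝ :=
  ∫ F : LagrangianPlane, projectionArea K F.1 ∂haarLagrangian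

end HermitianPlane

end

/-!
The proof compares both sides of the identity with integrals over the shell
`{x ∉ K | dist (x, K) ≤ 1}` around a nonempty convex compact set `K ⊆ ℂ² = ℝ⁴`, and avoids both
polytopes and the classification of valuations. Let `p` be the nearest-point map of `K`, `y = p x`
and `n = x - y`; the pair `(y, n)` runs through the normal bundle of `K`. The map `p` is Lipschitz,
hence differentiable almost everywhere, and its derivative `Q` is symmetric with `Q n = 0` and
eigenvalues `q₁, q₂, q₃ ∈ [0, 1]` on `n^⊥` for a frame `b₁, b₂, b₃` of principal directions
(`IsNearestPointMap.exists_frame`).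

* The dilation `x ↦ y + s n` has the Jacobian `s ∏ⱼ (qⱼ + s (1 - qⱼ))`. By the change of variables
  formula, the volume of `K + s D` is a polynomial in `s`, and `κ₂ V₂(K)` is the integral over the
  shell of `r = ∑ⱼ (1 - qⱼ) q_k q_l` (`IsNearestPointMap.exists_isSteinerSequence`).

* For a plane `E`, the map `x ↦ Pr_E y + Pr_{E^⊥} n` is injective where its Jacobian does not vanish
  (`IsNearestPointMap.projection_injective`, by monotonicity of the normal bundle) and covers the
  product of the interior of `Pr_E K` with `E^⊥` (`IsNearestPointMap.exists_projection_eq`, by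
  maximising a linear functional on the fibres of `Pr_E`). Hence `κ₂ vol₂ (Pr_E K)` is the integral
  of its Jacobian over the points with `|Pr_{E^⊥} n| ≤ 1`. As everything is homogeneous under the
  dilations, it is also the integral over the shell of the Jacobian times
  `|n|² / |Pr_{E^⊥} n|²` (`IsNearestPointMap.lintegral_shell_projJacobian`).

* The last integrand is `∑ⱼ (1 - qⱼ) q_k q_l κ_E(b₀, bⱼ)` with `b₀ = n / |n|`, where the kernel
  `κ_E(b₀, m)` is the squared area of the projection of the square spanned by `b₀, m` to `E^⊥`,
  divided by `|Pr_{E^⊥} b₀|²`. For every orthonormal pair, the average of `κ_E` over the complex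
  lines plus twice its average over the Lagrangian planes is `1` (`lintegral_kernel_add`), so the
  combination of the two averages of the areas is the integral of `r`, divided by `κ₂`.

The averages of the kernel are computed for `b₀ = (1, 0)` and `m = (c i, w)`, with `c` real, by
averaging over rotations of the second coordinate. They reduce to moments of the orbit measure of
`U(2)` on the unit sphere. The only one that is not elementary is the average of `det(X, Y)² / |Y|²`
for a unit vector `X + iY`. It equals the average of `⟨X, Y⟩² / |Y|²`: the average of a function
homogeneous of degree two is proportional to its Lebesgue integral over the unit ball
(`lintegral_ball_eq`), and Lebesgue measure is invariant under the rotation of `X` alone.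
-/

noncomputable section

namespace HermitianPlane

/-! ### The nearest-point map of a convex body -/

section NearestPoint

variable {V : Type*} [NormedAddCommGroup V] [InnerProductSpace ℝ V]

/-- `p` is the nearest-point map of the convex set `K`, characterised by the variational
inequality: `x - p x` is an outer normal of `K` at `p x`. -/
structure IsNearestPointMap (K : Set V) (p : V → V) : Prop where
  mem : ∀ x, p x ∈ K
  inner_le : ∀ x, ∀ y ∈ K, inner ℝ (x - p x) (y - p x) ≤ 0

lemma exists_isNearestPointMap {K : Set V} (hK : IsCompact K) (hconv : Convex ℝ K)
    (hne : K.Nonempty) : ∃ p, IsNearestPointMap K p := by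
  have h (x : V) : ∃ y ∈ K, ∀ z ∈ K, inner ℝ (x - y) (z - y) ≤ 0 := by
    obtain ⟨y, hy, hxy⟩ := exists_norm_eq_iInf_of_complete_convex hne hK.isComplete hconv x
    exact ⟨y, hy, (norm_eq_iInf_iff_real_inner_le_zero hconv hy).mp hxy⟩
  choose p hp hp' using h
  exact ⟨p, hp, hp'⟩

namespace IsNearestPointMap

variable {K : Set V} {p : V → V} (hp : IsNearestPointMap K p)
include hp

lemma eq_of_inner_le {x y : V} (hy : y ∈ K) (h : ∀ z ∈ K, inner ℝ (x - y) (z - y) ≤ 0) :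
    p x = y := by
  have h1 := hp.inner_le x y hy
  have h2 := h (p x) (hp.mem x)
  have h3 : inner ℝ (p x - y) (p x - y) =
      inner ℝ (x - y) (p x - y) + inner ℝ (x - p x) (y - p x) := by
    simp only [inner_sub_left, inner_sub_right, real_inner_comm]; ring
  have h4 : p x - y = 0 := by
    rw [← real_inner_self_nonpos]
    linarith
  exact sub_eq_zero.mp h4

lemma apply_of_mem {x : V} (hx : x ∈ K) : p x = x :=
  hp.eq_of_inner_le hx fun z _ => by simp

lemma mem_iff {x : V} : x ∈ K ↔ x - p x = 0 :=
  ⟨fun h => by rw [hp.apply_of_mem h, sub_self], fun h => by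
    rw [sub_eq_zero.mp h]; exact hp.mem x⟩

/-- The nearest-point map is constant on the rays of the normal cones. -/
lemma apply_ray (x : V) {t : ℝ} (ht : 0 ≤ t) : p (p x + t • (x - p x)) = p x := by
  refine hp.eq_of_inner_le (hp.mem x) fun z hz => ?_
  rw [add_sub_cancel_left, inner_smul_left]
  exact mul_nonpos_of_nonneg_of_nonpos ht (hp.inner_le x z hz)

/-- The nearest-point map is firmly nonexpansive. -/
lemma norm_sq_le_inner (x y : V) : ‖p x - p y‖ ^ 2 ≤ inner ℝ (p x - p y) (x - y) := by
  have h1 := hp.inner_le x _ (hp.mem y)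
  have h2 := hp.inner_le y _ (hp.mem x)
  rw [← real_inner_self_eq_norm_sq]
  have : inner ℝ (p x - p y) (x - y) - inner ℝ (p x - p y) (p x - p y) =
      - inner ℝ (x - p x) (p y - p x) - inner ℝ (y - p y) (p x - p y) := by
    simp only [inner_sub_left, inner_sub_right, real_inner_comm]; ring
  linarith

lemma lipschitzWith : LipschitzWith 1 p := by
  refine LipschitzWith.of_dist_le_mul fun x y => ?_
  rw [dist_eq_norm, dist_eq_norm, NNReal.coe_one, one_mul]
  have h1 := hp.norm_sq_le_inner x y
  have h2 := real_inner_le_norm (p x - p y) (x - y)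
  nlinarith [norm_nonneg (p x - p y), norm_nonneg (x - y)]

lemma norm_sub_le (x : V) {y : V} (hy : y ∈ K) : ‖x - p x‖ ≤ ‖x - y‖ := by
  have h1 := hp.inner_le x y hy
  have h2 : ‖x - y‖ ^ 2 = ‖x - p x‖ ^ 2 - 2 * inner ℝ (x - p x) (y - p x) + ‖y - p x‖ ^ 2 := by
    rw [← norm_sub_sq_real]; congr 2; abel
  exact le_of_sq_le_sq (by nlinarith [sq_nonneg ‖y - p x‖]) (norm_nonneg _)

lemma mem_add_smul_closedBall {x : V} {s : ℝ} (hs : 0 ≤ s) :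
    x ∈ K + s • Metric.closedBall (0 : V) 1 ↔ ‖x - p x‖ ≤ s := by
  rw [smul_unitClosedBall_of_nonneg hs]
  constructor
  · rintro ⟨y, hy, z, hz, rfl⟩
    refine (hp.norm_sub_le _ hy).trans ?_
    simpa using hz
  · intro h
    exact ⟨p x, hp.mem x, x - p x, by simpa using h, by simp⟩

/-- The nearest-point map is the gradient of the convex function `⟨x, p x⟩ - ‖p x‖² / 2`. -/
lemma hasFDerivAt_potential (x : V) :
    HasFDerivAt (fun x => inner ℝ x (p x) - ‖p x‖ ^ 2 / 2) (innerSL ℝ (p x)) x := by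
  have hle (x y : V) : inner ℝ x (p y) - ‖p y‖ ^ 2 / 2 ≤ inner ℝ x (p x) - ‖p x‖ ^ 2 / 2 := by
    have h := hp.norm_sub_le x (hp.mem y)
    have h' : ‖x - p x‖ ^ 2 ≤ ‖x - p y‖ ^ 2 := by gcongr
    rw [norm_sub_sq_real, norm_sub_sq_real] at h'
    linarith
  rw [hasFDerivAt_iff_isLittleO]
  refine Asymptotics.IsBigO.trans_isLittleO (g := fun y => ‖y - x‖ ^ 2) ?_ ?_
  · refine Asymptotics.IsBigO.of_bound 1 (Filter.Eventually.of_forall fun y => ?_)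
    have h1 := hle y x
    have h2 := hle x y
    have h3 : inner ℝ (y - x) (p y - p x) ≤ ‖y - x‖ ^ 2 := by
      have h4 := real_inner_le_norm (y - x) (p y - p x)
      have h5 := hp.lipschitzWith.dist_le_mul y x
      rw [dist_eq_norm, dist_eq_norm, NNReal.coe_one, one_mul] at h5
      nlinarith [norm_nonneg (y - x)]
    simp only [inner_sub_left, inner_sub_right] at h3
    simp only [innerSL_apply_apply, inner_sub_right, real_inner_comm (p x)]
    simp only [norm_pow, norm_norm, one_mul]
    rw [Real.norm_eq_abs, abs_le]
    have e1 := real_inner_comm (p x) y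
    have e2 := real_inner_comm (p x) x
    constructor <;> nlinarith [sq_nonneg ‖y - x‖]
  · have : (fun y => ‖y - x‖ ^ 2) = fun y => ‖y - x‖ * ‖y - x‖ := by ext; ring
    rw [this]
    have h0 : (fun y => ‖y - x‖) =o[nhds x] fun _ => (1 : ℝ) := by
      rw [Asymptotics.isLittleO_one_iff]
      have : Continuous fun y => ‖y - x‖ := by fun_prop
      simpa using this.tendsto x
    simpa using (h0.mul_isBigO (Asymptotics.isBigO_refl (fun y => ‖y - x‖) (nhds x))).norm_right

/-- The derivative of the nearest-point map is symmetric, being a second derivative of the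
potential. -/
lemma inner_fderiv_comm {x : V} {Q : V →L[ℝ] V} (hQ : HasFDerivAt p Q x) (v w : V) :
    inner ℝ (Q v) w = inner ℝ v (Q w) := by
  have h : HasFDerivAt (fun x => innerSL ℝ (p x)) ((innerSL ℝ).comp Q) x :=
    (innerSL ℝ (E := V)).hasFDerivAt.comp x hQ
  have := second_derivative_symmetric (𝕜 := ℝ) hp.hasFDerivAt_potential h v w
  simpa [real_inner_comm] using this

/-- The infinitesimal form of firm nonexpansiveness: the eigenvalues of the derivative are in
`[0, 1]`. -/
lemma norm_fderiv_sq_le {x : V} {Q : V →L[ℝ] V} (hQ : HasFDerivAt p Q x) (v : V) :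
    ‖Q v‖ ^ 2 ≤ inner ℝ (Q v) v := by
  have hl := hQ.hasLineDerivAt v
  have hl' : Filter.Tendsto (fun t : ℝ => t⁻¹ • (p (x + t • v) - p x)) (nhdsWithin 0 {0}ᶜ)
      (nhds (Q v)) := by
    simpa using hl.tendsto_slope_zero
  have h1 := (hl'.norm.pow 2)
  have h2 := hl'.inner (tendsto_const_nhds (x := v)) (𝕜 := ℝ)
  refine le_of_tendsto_of_tendsto h1 h2 ?_
  filter_upwards [self_mem_nhdsWithin] with t ht
  have ht : t ≠ 0 := ht
  have h3 := hp.norm_sq_le_inner (x + t • v) x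
  rw [add_sub_cancel_left, inner_smul_right] at h3
  rw [norm_smul, inner_smul_left, mul_pow, norm_inv, Real.norm_eq_abs, inv_pow, sq_abs]
  simp only [conj_trivial]
  calc (t ^ 2)⁻¹ * ‖p (x + t • v) - p x‖ ^ 2
      ≤ (t ^ 2)⁻¹ * (t * inner ℝ (p (x + t • v) - p x) v) := by gcongr
    _ = _ := by field_simp

lemma fderiv_normal {x : V} {Q : V →L[ℝ] V} (hQ : HasFDerivAt p Q x) : Q (x - p x) = 0 := by
  have hl : HasDerivAt (fun t : ℝ => p (x + t • (x - p x))) (Q (x - p x)) 0 :=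
    hQ.hasLineDerivAt (x - p x)
  have h : (fun t : ℝ => p (x + t • (x - p x))) =ᶠ[nhds 0] fun _ => p x := by
    filter_upwards [Ioi_mem_nhds (show (-1 : ℝ) < 0 by norm_num)] with t ht
    have ht : -1 < t := ht
    conv_rhs => rw [← hp.apply_ray x (t := 1 + t) (by linarith)]
    congr 1
    module
  exact hl.unique ((hasDerivAt_const (0 : ℝ) (p x)).congr_of_eventuallyEq h)

end IsNearestPointMap

end NearestPoint

/-! ### Determinants in a frame of principal directions -/

section Determinants

variable {V : Type*} [NormedAddCommGroup V] [InnerProductSpace ℝ V]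

/-- `b` is an orthonormal frame that diagonalises `Q` with eigenvalues `q i ∈ [0, 1]`, and its
first vector spans the ray of `n` and is in the kernel of `Q`. -/
structure IsPrincipalFrame (Q : V →L[ℝ] V) (n : V) (b : OrthonormalBasis (Fin 4) ℝ V)
    (q : Fin 4 → ℝ) : Prop where
  smul_eq : ‖n‖ • b 0 = n
  apply_eq : ∀ i, Q (b i) = q i • b i
  zero_eq : q 0 = 0
  nonneg : ∀ i, 0 ≤ q i
  le_one : ∀ i, q i ≤ 1

lemma exists_isPrincipalFrame [FiniteDimensional ℝ V] (hV : Module.finrank ℝ V = 4)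
    {Q : V →L[ℝ] V} {n : V} (hn : n ≠ 0) (hsymm : ∀ v w, inner ℝ (Q v) w = inner ℝ v (Q w))
    (hQn : Q n = 0)
    (hle : ∀ v, ‖Q v‖ ^ 2 ≤ inner ℝ (Q v) v) : ∃ b q, IsPrincipalFrame Q n b q := by
  have hS : (Q : V →ₗ[ℝ] V).IsSymmetric := hsymm
  have hinv : ∀ v ∈ (Submodule.span ℝ {n})ᗮ, (Q : V →ₗ[ℝ] V) v ∈ (Submodule.span ℝ {n})ᗮ := by
    intro v _
    rw [Submodule.mem_orthogonal_singleton_iff_inner_right]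
    change inner ℝ n (Q v) = 0
    rw [← hsymm, hQn, inner_zero_left]
  have hS' := hS.restrict_invariant hinv
  have hfr : Module.finrank ℝ (Submodule.span ℝ {n})ᗮ = 3 := by
    have : Fact (Module.finrank ℝ V = 3 + 1) := ⟨hV⟩
    exact Submodule.finrank_orthogonal_span_singleton hn
  let e := hS'.eigenvectorBasis hfr
  let w : Fin 4 → V := Fin.cons (‖n‖⁻¹ • n) fun j => (e j : V)
  have hn' : ‖n‖ ≠ 0 := norm_ne_zero_iff.mpr hn
  have hen (j) : inner ℝ n (e j : V) = 0 :=
    Submodule.mem_orthogonal_singleton_iff_inner_right.mp (e j).2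
  have hw : Orthonormal ℝ w := by
    constructor
    · intro i
      refine Fin.cases ?_ (fun j => ?_) i
      · simp [w, norm_smul, hn']
      · simp only [w, Fin.cons_succ]
        exact e.orthonormal.1 j
    · intro i
      refine Fin.cases ?_ (fun j => ?_) i <;> intro k <;> refine Fin.cases ?_ (fun l => ?_) k <;>
        intro hkl
      · exact absurd rfl hkl
      · simp [w, inner_smul_left, hen]
      · simp only [w, Fin.cons_succ, Fin.cons_zero, inner_smul_right]
        rw [real_inner_comm, hen, mul_zero]
      · have hjl : j ≠ l := fun h => hkl (by rw [h])
        have := e.orthonormal.2 hjl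
        simpa [w] using this
  have hcard : Fintype.card (Fin 4) = Module.finrank ℝ V := by simp [hV]
  let B := basisOfOrthonormalOfCardEqFinrank hw hcard
  have hB : ⇑B = w := coe_basisOfOrthonormalOfCardEqFinrank hw hcard
  let b := B.toOrthonormalBasis (by rw [hB]; exact hw)
  have hb : ⇑b = w := by simp [b, hB]
  let q : Fin 4 → ℝ := Fin.cons 0 fun j => hS'.eigenvalues hfr j
  have happ (i) : Q (b i) = q i • b i := by
    rw [hb]
    refine Fin.cases ?_ (fun j => ?_) i
    · simp [w, q, hQn]
    · exact congrArg Subtype.val (hS'.apply_eigenvectorBasis hfr j)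
  have hq (i) : q i ^ 2 ≤ q i := by
    have := hle (b i)
    have h1 : ‖b i‖ = 1 := b.orthonormal.1 i
    rw [happ, norm_smul, inner_smul_left, real_inner_self_eq_norm_sq, h1] at this
    simpa using this
  refine ⟨b, q, ?_, happ, rfl, fun i => ?_, fun i => ?_⟩
  · rw [hb]; simp [w, smul_smul, hn']
  · nlinarith [hq i]
  · nlinarith [hq i]

variable {Q : V →L[ℝ] V} {n : V} {b : OrthonormalBasis (Fin 4) ℝ V} {q : Fin 4 → ℝ}

/-- The sum `∑ⱼ (1 - qⱼ) q_k q_l`, where `{j, k, l} = {1, 2, 3}`: the coefficient of `s²` in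
`det (Q + s (1 - Q))`. For a polytope, it is the indicator of the points whose nearest point is in
a two-dimensional face. -/
def faceDensity (q : Fin 4 → ℝ) : ℝ :=
  (1 - q 1) * q 2 * q 3 + (1 - q 2) * q 1 * q 3 + (1 - q 3) * q 1 * q 2

lemma IsPrincipalFrame.det_dilation (h : IsPrincipalFrame Q n b q) (s : ℝ) :
    (Q + s • (1 - Q)).det = ∏ i, (q i + s * (1 - q i)) := by
  have : LinearMap.toMatrix b.toBasis b.toBasis ((Q + s • (1 - Q) : V →L[ℝ] V) : V →ₗ[ℝ] V) =
      Matrix.diagonal fun i => q i + s * (1 - q i) := by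
    ext i j
    rw [LinearMap.toMatrix_apply]
    have : (Q + s • (1 - Q)) (b j) = (q j + s * (1 - q j)) • b j := by
      simp [h.apply_eq]; module
    simp only [OrthonormalBasis.coe_toBasis, ContinuousLinearMap.coe_coe, this,
      map_smul]
    by_cases hij : i = j
    · subst hij; simp
    · simp [hij]
  rw [ContinuousLinearMap.det, ← LinearMap.det_toMatrix b.toBasis, this, Matrix.det_diagonal]

/-- `P` is the orthogonal projection along the orthonormal pair `f₀, f₁`; in dimension four, it is
the projection to the plane orthogonal to `f₀` and `f₁`. -/
structure IsPlaneProjection (P : V →L[ℝ] V) (f₀ f₁ : V) : Prop where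
  norm₀ : ‖f₀‖ = 1
  norm₁ : ‖f₁‖ = 1
  inner_eq : inner ℝ f₀ f₁ = 0
  apply_eq : ∀ x, P x = x - inner ℝ f₀ x • f₀ - inner ℝ f₁ x • f₁

/-- The squared area of the projection of the parallelogram spanned by `n, m` to the plane spanned
by the orthonormal pair `f₀, f₁`. -/
def pairing (f₀ f₁ n m : V) : ℝ :=
  (inner ℝ f₀ n * inner ℝ f₁ m - inner ℝ f₀ m * inner ℝ f₁ n) ^ 2

/-- The Jacobian of the map `x ↦ Pr_E y + t Pr_{E^⊥} n` in a principal frame, for a plane `E`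
with orthogonal complement spanned by the orthonormal pair `f₀, f₁`. Each column of the matrix is a
combination of a column of `Pr_E` and one of `Pr_{E^⊥}`, and as both have rank two, only the
products with two columns of each survive in the expansion. -/
lemma IsPrincipalFrame.det_projection (h : IsPrincipalFrame Q n b q) {P : V →L[ℝ] V} {f₀ f₁ : V}
    (hP : IsPlaneProjection P f₀ f₁) (t : ℝ) :
    (P * Q + (t • (1 - P)) * (1 - Q)).det =
      t ^ 2 * ((1 - q 1) * q 2 * q 3 * pairing f₀ f₁ (b 0) (b 1) +
        (1 - q 2) * q 1 * q 3 * pairing f₀ f₁ (b 0) (b 2) +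
        (1 - q 3) * q 1 * q 2 * pairing f₀ f₁ (b 0) (b 3)) := by
  set u : Fin 4 → ℝ := fun i => inner ℝ f₀ (b i) with hu
  set v : Fin 4 → ℝ := fun i => inner ℝ f₁ (b i) with hv
  have huu : u 0 ^ 2 + u 1 ^ 2 + u 2 ^ 2 + u 3 ^ 2 = 1 := by
    have := b.sum_inner_mul_inner f₀ f₀
    rw [real_inner_self_eq_norm_sq, hP.norm₀, Fin.sum_univ_four] at this
    simp only [real_inner_comm f₀] at this
    simp only [hu]; linarith
  have hvv : v 0 ^ 2 + v 1 ^ 2 + v 2 ^ 2 + v 3 ^ 2 = 1 := by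
    have := b.sum_inner_mul_inner f₁ f₁
    rw [real_inner_self_eq_norm_sq, hP.norm₁, Fin.sum_univ_four] at this
    simp only [real_inner_comm f₁] at this
    simp only [hv]; linarith
  have huv : u 0 * v 0 + u 1 * v 1 + u 2 * v 2 + u 3 * v 3 = 0 := by
    have := b.sum_inner_mul_inner f₀ f₁
    rw [hP.inner_eq, Fin.sum_univ_four] at this
    simp only [real_inner_comm f₁] at this
    simp only [hu, hv]; linarith
  have hM : LinearMap.toMatrix b.toBasis b.toBasis
      ((P * Q + (t • (1 - P)) * (1 - Q) : V →L[ℝ] V) : V →ₗ[ℝ] V) =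
      Matrix.of fun i j => (if i = j then 1 else 0) * q j +
        (t * (1 - q j) - q j) * (u i * u j + v i * v j) := by
    ext i j
    rw [LinearMap.toMatrix_apply]
    have : (P * Q + (t • (1 - P)) * (1 - Q)) (b j) = q j • b j +
        ((t * (1 - q j) - q j) * u j) • f₀ + ((t * (1 - q j) - q j) * v j) • f₁ := by
      simp only [add_apply, mul_apply_eq_comp, smul_apply,
        sub_apply, one_apply_eq_self, h.apply_eq, hP.apply_eq, map_sub,
        inner_smul_right, hu, hv]
      module
    rw [OrthonormalBasis.coe_toBasis, ContinuousLinearMap.coe_coe, this,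
      OrthonormalBasis.coe_toBasis_repr_apply, b.repr_apply_apply, inner_add_right,
      inner_add_right, inner_smul_right, inner_smul_right, inner_smul_right,
      orthonormal_iff_ite.mp b.orthonormal, real_inner_comm f₀, real_inner_comm f₁]
    simp only [Matrix.of_apply, hu, hv]
    ring
  rw [ContinuousLinearMap.det, ← LinearMap.det_toMatrix b.toBasis, hM]
  have hq0 := h.zero_eq
  change _ = t ^ 2 * ((1 - q 1) * q 2 * q 3 * (u 0 * v 1 - u 1 * v 0) ^ 2 +
      (1 - q 2) * q 1 * q 3 * (u 0 * v 2 - u 2 * v 0) ^ 2 +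
      (1 - q 3) * q 1 * q 2 * (u 0 * v 3 - u 3 * v 0) ^ 2)
  clear_value u v
  simp [Matrix.det_succ_row_zero, Fin.sum_univ_succ, Fin.succAbove, hq0]
  linear_combination t * q 1 * q 2 * q 3 *
    (-(v 0) ^ 2 * huu - u 0 ^ 2 * hvv + 2 * u 0 * v 0 * huv)

end Determinants

/-! ### Changes of variables on the normal bundle -/

section ChangeOfVariables

variable {V : Type*} [NormedAddCommGroup V] [InnerProductSpace ℝ V]

/-- The map `x ↦ A y + B n` of the normal bundle of a convex body, where `y = p x` is the nearest
point and `n = x - y` is the outer normal. -/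
def bundleMap (p : V → V) (A B : V →L[ℝ] V) (x : V) : V := A (p x) + B (x - p x)

/-- The derivative of `bundleMap p A B`. -/
def bundleDeriv (p : V → V) (A B : V →L[ℝ] V) (x : V) : V →L[ℝ] V :=
  A * fderiv ℝ p x + B * (1 - fderiv ℝ p x)

lemma hasFDerivAt_bundleMap {p : V → V} {x : V} (hx : DifferentiableAt ℝ p x) (A B : V →L[ℝ] V) :
    HasFDerivAt (bundleMap p A B) (bundleDeriv p A B x) x := by
  have h1 := hx.hasFDerivAt
  exact (A.hasFDerivAt.comp x h1).add (B.hasFDerivAt.comp x ((hasFDerivAt_id x).sub h1))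

lemma lipschitzWith_bundleMap {p : V → V} (hp : LipschitzWith 1 p) (A B : V →L[ℝ] V) :
    ∃ C, LipschitzWith C (bundleMap p A B) :=
  ⟨_, (A.lipschitz.comp hp).add (B.lipschitz.comp (LipschitzWith.id.sub hp))⟩

variable [FiniteDimensional ℝ V] [MeasurableSpace V] [BorelSpace V]

lemma volume_image_eq_zero_of_lipschitzWith {f : V → V} {C : NNReal} (hf : LipschitzWith C f)
    {s : Set V} (hs : volume s = 0) : volume (f '' s) = 0 := by
  have h1 : Measure.hausdorffMeasure (Module.finrank ℝ V) s = 0 :=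
    Measure.absolutelyContinuous_isAddHaarMeasure _ volume hs
  have h2 := hf.hausdorffMeasure_image_le (d := Module.finrank ℝ V) (by positivity) s
  rw [h1, mul_zero, nonpos_iff_eq_zero] at h2
  exact Measure.absolutelyContinuous_isAddHaarMeasure volume
    (Measure.hausdorffMeasure (Module.finrank ℝ V)) h2

lemma measurable_bundleDeriv (p : V → V) (A B : V →L[ℝ] V) :
    Measurable fun x => (bundleDeriv p A B x).det := by
  have h : Continuous fun Q : V →L[ℝ] V => (A * Q + B * (1 - Q)).det :=
    ContinuousLinearMap.continuous_det.comp (by fun_prop)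
  exact h.measurable.comp (measurable_fderiv ℝ p)

variable {K : Set V} {p : V → V} (hp : IsNearestPointMap K p)
include hp

namespace IsNearestPointMap

lemma ae_differentiableAt : ∀ᵐ x, DifferentiableAt ℝ p x := hp.lipschitzWith.ae_differentiableAt

lemma exists_frame (hV : Module.finrank ℝ V = 4) {x : V} (hx : x ∉ K)
    (hd : DifferentiableAt ℝ p x) : ∃ b q, IsPrincipalFrame (fderiv ℝ p x) (x - p x) b q :=
  exists_isPrincipalFrame hV (fun h => hx (hp.mem_iff.mpr h))
    (hp.inner_fderiv_comm hd.hasFDerivAt) (hp.fderiv_normal hd.hasFDerivAt)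
    (hp.norm_fderiv_sq_le hd.hasFDerivAt)

lemma apply_dilation (x : V) {s : ℝ} (hs : 0 ≤ s) : p (bundleMap p 1 (s • 1) x) = p x :=
  hp.apply_ray x hs

lemma dilation_sub (x : V) {s : ℝ} (hs : 0 ≤ s) :
    bundleMap p 1 (s • 1) x - p (bundleMap p 1 (s • 1) x) = s • (x - p x) := by
  rw [hp.apply_dilation x hs]; simp [bundleMap]

lemma dilation_dilation (x : V) {s t : ℝ} (hs : 0 ≤ s) (hst : t * s = 1) :
    bundleMap p 1 (t • 1) (bundleMap p 1 (s • 1) x) = x := by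
  conv_lhs => rw [bundleMap]
  rw [hp.dilation_sub x hs, hp.apply_dilation x hs]
  simp [smul_smul, mul_comm s t, hst]

lemma dilation_notMem {x : V} (hx : x ∉ K) {s : ℝ} (hs : 0 < s) : bundleMap p 1 (s • 1) x ∉ K := by
  rw [hp.mem_iff, hp.dilation_sub x hs.le, smul_eq_zero, not_or]
  exact ⟨hs.ne', fun h => hx (hp.mem_iff.mpr h)⟩

lemma volume_dilation_preimage {s : ℝ} (hs : 0 < s) {N : Set V} (hN : volume N = 0) :
    volume (bundleMap p 1 (s • 1) ⁻¹' N) = 0 := by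
  obtain ⟨C, hC⟩ := lipschitzWith_bundleMap hp.lipschitzWith 1 (s⁻¹ • 1)
  refine measure_mono_null (fun x hx => ?_) (volume_image_eq_zero_of_lipschitzWith hC hN)
  exact ⟨_, hx, hp.dilation_dilation x hs.le (inv_mul_cancel₀ hs.ne')⟩

/-- Change of variables for the dilations of the normal bundle. -/
lemma lintegral_dilation (hK : IsClosed K) {s : ℝ} (hs : 0 < s) (H : V → ENNReal) :
    ∫⁻ x in Kᶜ, H x = ∫⁻ x in Kᶜ,
      ENNReal.ofReal |(bundleDeriv p 1 (s • 1) x).det| * H (bundleMap p 1 (s • 1) x) := by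
  set σ := bundleMap p 1 (s • 1) with hσ
  set R := {x | DifferentiableAt ℝ p x} with hR
  have hRm : MeasurableSet R := measurableSet_of_differentiableAt ℝ p
  have hRae : volume Rᶜ = 0 := hp.ae_differentiableAt
  have hm : MeasurableSet (Kᶜ ∩ R) := hK.measurableSet.compl.inter hRm
  have hinj : Function.Injective σ :=
    Function.LeftInverse.injective (g := bundleMap p 1 (s⁻¹ • 1))
      fun x => hp.dilation_dilation x hs.le (inv_mul_cancel₀ hs.ne')
  have himg : (σ '' (Kᶜ ∩ R) : Set V) =ᵐ[volume] (Kᶜ : Set V) := by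
    have hsub : σ '' (Kᶜ ∩ R) ⊆ Kᶜ := by
      rintro _ ⟨x, hx, rfl⟩; exact hp.dilation_notMem hx.1 hs
    refine (LE.le.eventuallyLE hsub).antisymm ?_
    rw [ae_le_set]
    refine measure_mono_null (t := σ '' Rᶜ) ?_ ?_
    · rintro y ⟨hy, hy'⟩
      have h1 : σ (bundleMap p 1 (s⁻¹ • 1) y) = y :=
        hp.dilation_dilation y (inv_nonneg.mpr hs.le) (mul_inv_cancel₀ hs.ne')
      refine ⟨_, fun h2 => hy' ⟨_, ⟨?_, h2⟩, h1⟩, h1⟩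
      exact hp.dilation_notMem hy (inv_pos.mpr hs)
    · obtain ⟨C, hC⟩ := lipschitzWith_bundleMap hp.lipschitzWith 1 (s • 1)
      exact volume_image_eq_zero_of_lipschitzWith hC hRae
  have hres : (Kᶜ ∩ R : Set V) =ᵐ[volume] (Kᶜ : Set V) := by
    filter_upwards [hp.ae_differentiableAt] with x hx
    simp only [Set.inter_def, hR]
    exact propext ⟨fun h => h.1, fun h => ⟨h, hx⟩⟩
  rw [← setLIntegral_congr himg, ← setLIntegral_congr hres]
  exact lintegral_image_eq_lintegral_abs_det_fderiv_mul volume hm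
    (fun x hx => (hasFDerivAt_bundleMap hx.2 _ _).hasFDerivWithinAt) hinj.injOn H

lemma ae_compl {q : V → Prop} (hK : IsClosed K) (h : ∀ x ∉ K, DifferentiableAt ℝ p x → q x) :
    ∀ᵐ x ∂volume.restrict Kᶜ, q x := by
  rw [ae_restrict_iff' hK.measurableSet.compl]
  filter_upwards [hp.ae_differentiableAt] with x hx hx'
  exact h x hx' hx

end IsNearestPointMap
end ChangeOfVariables

/-! ### The Steiner formula -/

section Steiner

variable {V : Type*} [NormedAddCommGroup V] [InnerProductSpace ℝ V]

/-- In dimension four, `det (Q + s (1 - Q)) = ∑ k, dilationCoeff Q k * s ^ (k + 1)` when `Q` is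
singular. The coefficients are written as combinations of the values at `s = ±1, ±2`, which makes
their measurability in `Q` evident. -/
def dilationCoeff (Q : V →L[ℝ] V) : Fin 4 → ℝ :=
  let d : ℝ → ℝ := fun s => (Q + s • (1 - Q)).det
  ![(8 * (d 1 - d (-1)) - (d 2 - d (-2))) / 12, (16 * (d 1 + d (-1)) - (d 2 + d (-2))) / 24,
    ((d 2 - d (-2)) - 2 * (d 1 - d (-1))) / 12, ((d 2 + d (-2)) - 4 * (d 1 + d (-1))) / 24]

lemma continuous_dilationCoeff (k : Fin 4) :
    Continuous fun Q : V →L[ℝ] V => dilationCoeff Q k := by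
  have h (s : ℝ) : Continuous fun Q : V →L[ℝ] V => (Q + s • (1 - Q)).det :=
    ContinuousLinearMap.continuous_det.comp (by fun_prop)
  have h1 := h 1
  have h2 := h (-1)
  have h3 := h 2
  have h4 := h (-2)
  fin_cases k <;> simp only [dilationCoeff, Fin.zero_eta, Fin.mk_one, Fin.reduceFinMk,
    Matrix.cons_val_zero, Matrix.cons_val_one, Matrix.cons_val] <;> fun_prop

section Frame

variable {Q : V →L[ℝ] V} {n : V} {b : OrthonormalBasis (Fin 4) ℝ V} {q : Fin 4 → ℝ}

lemma IsPrincipalFrame.dilationCoeff_eq (h : IsPrincipalFrame Q n b q) :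
    dilationCoeff Q = ![q 1 * q 2 * q 3, faceDensity q,
      q 1 * (1 - q 2) * (1 - q 3) + q 2 * (1 - q 1) * (1 - q 3) + q 3 * (1 - q 1) * (1 - q 2),
      (1 - q 1) * (1 - q 2) * (1 - q 3)] := by
  unfold dilationCoeff faceDensity
  simp only [h.det_dilation, Fin.prod_univ_four, h.zero_eq]
  congr 1
  · ring
  · congr 1
    · ring
    · congr 1
      · ring
      · congr 1
        ring

lemma IsPrincipalFrame.faceDensity_nonneg (h : IsPrincipalFrame Q n b q) : 0 ≤ faceDensity q := by
  have h1 := h.nonneg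
  have h2 := fun i => sub_nonneg.mpr (h.le_one i)
  exact add_nonneg (add_nonneg (mul_nonneg (mul_nonneg (h2 1) (h1 2)) (h1 3))
    (mul_nonneg (mul_nonneg (h2 2) (h1 1)) (h1 3))) (mul_nonneg (mul_nonneg (h2 3) (h1 1)) (h1 2))

lemma IsPrincipalFrame.dilationCoeff_nonneg (h : IsPrincipalFrame Q n b q) (k : Fin 4) :
    0 ≤ dilationCoeff Q k := by
  have h1 := h.nonneg
  have h2 := fun i => sub_nonneg.mpr (h.le_one i)
  rw [h.dilationCoeff_eq]
  fin_cases k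
  · exact mul_nonneg (mul_nonneg (h1 1) (h1 2)) (h1 3)
  · exact h.faceDensity_nonneg
  · exact add_nonneg (add_nonneg (mul_nonneg (mul_nonneg (h1 1) (h2 2)) (h2 3))
      (mul_nonneg (mul_nonneg (h1 2) (h2 1)) (h2 3)))
      (mul_nonneg (mul_nonneg (h1 3) (h2 1)) (h2 2))
  · exact mul_nonneg (mul_nonneg (h2 1) (h2 2)) (h2 3)

lemma IsPrincipalFrame.det_dilation_eq_sum (h : IsPrincipalFrame Q n b q) (s : ℝ) :
    (Q + s • (1 - Q)).det = ∑ k : Fin 4, dilationCoeff Q k * s ^ (k.1 + 1) := by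
  rw [h.dilationCoeff_eq, h.det_dilation, Fin.prod_univ_four, Fin.sum_univ_four, h.zero_eq]
  simp [faceDensity]
  ring

end Frame

variable [FiniteDimensional ℝ V] [MeasurableSpace V] [BorelSpace V]

/-- The integrals over the outer shell `0 < dist (x, K) ≤ 1` of the coefficients of the Jacobian of
the dilations of the normal bundle. -/
def shellIntegral (K : Set V) (p : V → V) (k : Fin 4) : ENNReal :=
  ∫⁻ x in Kᶜ ∩ {x | ‖x - p x‖ ≤ 1}, ENNReal.ofReal (dilationCoeff (fderiv ℝ p x) k)

lemma unitBallVolume_pos (m : ℕ) : 0 < unitBallVolume m :=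
  ENNReal.toReal_pos (Metric.measure_closedBall_pos _ _ one_pos).ne'
    measure_closedBall_lt_top.ne

lemma measurableSet_shell {K : Set V} {p : V → V} (hp : IsNearestPointMap K p) (r : ℝ) :
    MeasurableSet {x | ‖x - p x‖ ≤ r} :=
  measurableSet_le ((measurable_id.sub hp.lipschitzWith.continuous.measurable).norm)
    measurable_const

namespace IsNearestPointMap

variable {K : Set V} {p : V → V} (hp : IsNearestPointMap K p)
include hp

lemma volume_parallelBody (hK : IsClosed K) (hV : Module.finrank ℝ V = 4) {s : ℝ} (hs : 0 < s) :
    volume (K + s • Metric.closedBall (0 : V) 1) =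
      volume K + ∑ k : Fin 4, ENNReal.ofReal (s ^ (k.1 + 1)) * shellIntegral K p k := by
  have hset : K + s • Metric.closedBall (0 : V) 1 = {x | ‖x - p x‖ ≤ s} :=
    Set.ext fun x => hp.mem_add_smul_closedBall hs.le
  have hsub : K ⊆ {x | ‖x - p x‖ ≤ s} := fun x hx => by
    simpa [hp.mem_iff.mp hx] using hs.le
  rw [hset, ← measure_inter_add_sdiff _ hK.measurableSet, Set.inter_eq_self_of_subset_right hsub]
  congr 1
  have hind : volume ({x | ‖x - p x‖ ≤ s} \ K) =
      ∫⁻ x in Kᶜ, Set.indicator {x | ‖x - p x‖ ≤ s} 1 x := by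
    rw [lintegral_indicator_one (measurableSet_shell hp s),
      Measure.restrict_apply (measurableSet_shell hp s), Set.sdiff_eq]
  have hm (k : Fin 4) : Measurable fun x => dilationCoeff (fderiv ℝ p x) k :=
    (continuous_dilationCoeff k).measurable.comp (measurable_fderiv ℝ p)
  rw [hind, hp.lintegral_dilation hK hs]
  simp only [shellIntegral]
  rw [Set.inter_comm]
  simp only [← Measure.restrict_restrict (measurableSet_shell hp 1)]
  simp only [← lintegral_indicator (measurableSet_shell hp 1)]
  simp_rw [← lintegral_const_mul' _ _ ENNReal.ofReal_ne_top]
  rw [← lintegral_finsetSum _ fun k _ => (((hm k).ennreal_ofReal.indicator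
    (measurableSet_shell hp 1)).const_mul _)]
  refine lintegral_congr_ae (hp.ae_compl hK fun x hx hd => ?_)
  obtain ⟨b, q, hf⟩ := hp.exists_frame hV hx hd
  have hdet : (bundleDeriv p 1 (s • 1) x).det =
      ∑ k : Fin 4, dilationCoeff (fderiv ℝ p x) k * s ^ (k.1 + 1) := by
    rw [← hf.det_dilation_eq_sum]
    congr 1
  have hnn (k : Fin 4) : 0 ≤ dilationCoeff (fderiv ℝ p x) k * s ^ (k.1 + 1) :=
    mul_nonneg (hf.dilationCoeff_nonneg k) (by positivity)
  have hmem : bundleMap p 1 (s • 1) x ∈ {x | ‖x - p x‖ ≤ s} ↔ x ∈ {x | ‖x - p x‖ ≤ 1} := by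
    simp only [Set.mem_ofPred_eq]
    rw [hp.dilation_sub x hs.le, norm_smul, Real.norm_eq_abs, abs_of_pos hs]
    exact mul_le_iff_le_one_right hs
  beta_reduce
  rw [hdet, abs_of_nonneg (Finset.sum_nonneg fun k _ => hnn k),
    ENNReal.ofReal_sum_of_nonneg fun k _ => hnn k]
  by_cases hx1 : x ∈ {x | ‖x - p x‖ ≤ 1}
  · simp only [Set.indicator_of_mem hx1, Set.indicator_of_mem (hmem.mpr hx1), Pi.one_apply, mul_one]
    refine Finset.sum_congr rfl fun k _ => ?_
    rw [mul_comm, ENNReal.ofReal_mul (by positivity)]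
  · simp [Set.indicator_of_notMem hx1, Set.indicator_of_notMem (fun h => hx1 (hmem.mp h))]

lemma shellIntegral_ne_top (hK : IsCompact K) (hV : Module.finrank ℝ V = 4) (k : Fin 4) :
    shellIntegral K p k ≠ ⊤ := by
  have h := hp.volume_parallelBody hK.isClosed hV one_pos
  have h1 : volume (K + (1 : ℝ) • Metric.closedBall (0 : V) 1) ≠ ⊤ := by
    rw [one_smul]
    exact (hK.add (isCompact_closedBall 0 1)).measure_lt_top.ne
  rw [h] at h1
  have h2 := (ENNReal.sum_ne_top.mp (ENNReal.add_ne_top.mp h1).2) k (Finset.mem_univ k)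
  simpa using h2

/-- The Steiner formula in dimension four. -/
lemma exists_isSteinerSequence (hK : IsCompact K) (hV : Module.finrank ℝ V = 4) :
    ∃ v, IsSteinerSequence K v ∧ unitBallVolume 2 * v 2 = (shellIntegral K p 1).toReal := by
  have hκ (m : ℕ) := (unitBallVolume_pos m).ne'
  let c (k : Fin 4) : ℝ := (shellIntegral K p k).toReal
  let v : ℕ → ℝ := fun j => match j with
    | 0 => c 3 / unitBallVolume 4
    | 1 => c 2 / unitBallVolume 3
    | 2 => c 1 / unitBallVolume 2
    | 3 => c 0 / unitBallVolume 1
    | 4 => volume.real K / unitBallVolume 0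
    | _ => 0
  refine ⟨v, ⟨fun j hj => ?_, fun ε hε => ?_⟩, ?_⟩
  · rw [hV] at hj
    match j, hj with
    | j + 5, _ => rfl
  · have hsum : ∑ j ∈ Finset.range (Module.finrank ℝ V + 1),
        unitBallVolume (Module.finrank ℝ V - j) * v j * ε ^ (Module.finrank ℝ V - j) =
        volume.real K + ∑ k : Fin 4, ε ^ (k.1 + 1) * c k := by
      rw [hV, Fin.sum_univ_four]
      simp only [Finset.sum_range_succ, Finset.sum_range_zero, v]
      simp only [tsub_zero, Nat.reduceSub, mul_div_cancel₀ _ (hκ _)]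
      simp
      ring
    rw [hsum]
    rcases hε.eq_or_lt with rfl | hε
    · rw [smul_unitClosedBall_of_nonneg le_rfl]
      simp
    · rw [measureReal_def, hp.volume_parallelBody hK.isClosed hV hε, ENNReal.toReal_add
        hK.measure_lt_top.ne, ENNReal.toReal_sum]
      · simp only [ENNReal.toReal_mul, ENNReal.toReal_ofReal (pow_nonneg hε.le _), c,
          measureReal_def]
      · exact fun k _ => ENNReal.mul_ne_top ENNReal.ofReal_ne_top (hp.shellIntegral_ne_top hK hV k)
      · exact ENNReal.sum_ne_top.mpr fun k _ =>
          ENNReal.mul_ne_top ENNReal.ofReal_ne_top (hp.shellIntegral_ne_top hK hV k)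
  · exact mul_div_cancel₀ _ (hκ 2)

end IsNearestPointMap

/-- The coefficients of the Steiner polynomial are determined by five of its values. -/
lemma IsSteinerSequence.intrinsicVolume_two_eq (hV : Module.finrank ℝ V = 4) {K : Set V}
    {v : ℕ → ℝ} (hv : IsSteinerSequence K v) : intrinsicVolume 2 K = v 2 := by
  have hex : ∃ v, IsSteinerSequence K v := ⟨v, hv⟩
  have hw := hex.choose_spec
  rw [intrinsicVolume, dif_pos hex]
  generalize hex.choose = w at hw
  have h (ε : ℝ) (hε : 0 ≤ ε) := (hw.2 ε hε).symm.trans (hv.2 ε hε)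
  rw [hV] at h
  simp only [Finset.sum_range_succ, Finset.sum_range_zero, tsub_zero, Nat.reduceSub] at h
  have h0 : unitBallVolume 0 * w 4 = unitBallVolume 0 * v 4 := by linear_combination h 0 le_rfl
  have h1 := h 1 zero_le_one
  have h2 := h 2 zero_le_two
  have h3 := h 3 zero_le_three
  have h4 := h 4 zero_le_four
  norm_num at h1 h2 h3 h4
  have h5 : unitBallVolume 2 * w 2 = unitBallVolume 2 * v 2 := by linarith
  exact mul_left_cancel₀ (unitBallVolume_pos 2).ne' h5

end Steiner

/-! ### The map of the normal bundle attached to a projection -/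

section Projection

variable {V : Type*} [NormedAddCommGroup V] [InnerProductSpace ℝ V]

namespace IsPlaneProjection

variable {P : V →L[ℝ] V} {f₀ f₁ : V} (hP : IsPlaneProjection P f₀ f₁)
include hP

lemma apply_fst : P f₀ = 0 := by
  rw [hP.apply_eq, real_inner_self_eq_norm_sq, hP.norm₀, real_inner_comm, hP.inner_eq]; simp

lemma apply_snd : P f₁ = 0 := by
  rw [hP.apply_eq, real_inner_self_eq_norm_sq, hP.norm₁, hP.inner_eq]; simp

lemma apply_apply (x : V) : P (P x) = P x := by
  conv_lhs => rw [hP.apply_eq x]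
  simp [hP.apply_fst, hP.apply_snd]

lemma inner_comm (x y : V) : inner ℝ (P x) y = inner ℝ x (P y) := by
  simp only [hP.apply_eq, inner_sub_left, inner_sub_right, inner_smul_left, inner_smul_right,
    conj_trivial, real_inner_comm x]
  ring

lemma norm_sub_sq (x : V) : ‖x - P x‖ ^ 2 = inner ℝ f₀ x ^ 2 + inner ℝ f₁ x ^ 2 := by
  rw [hP.apply_eq, ← real_inner_self_eq_norm_sq]
  have : x - (x - inner ℝ f₀ x • f₀ - inner ℝ f₁ x • f₁) =
    inner ℝ f₀ x • f₀ + inner ℝ f₁ x • f₁ := by abel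
  rw [this]
  simp only [inner_add_left, inner_add_right, inner_smul_left, inner_smul_right, conj_trivial,
    real_inner_comm f₀ f₁, hP.inner_eq, real_inner_self_eq_norm_sq, hP.norm₀, hP.norm₁]
  ring

lemma apply_bundleMap (p : V → V) (x : V) : P (bundleMap p P (1 - P) x) = P (p x) := by
  simp [bundleMap, hP.apply_apply]

lemma bundleMap_sub (p : V → V) (x : V) :
    bundleMap p P (1 - P) x - P (bundleMap p P (1 - P) x) = (x - p x) - P (x - p x) := by
  rw [hP.apply_bundleMap]; simp [bundleMap]

end IsPlaneProjection

lemma IsPrincipalFrame.pairing_zero_of_sub_eq_zero {Q : V →L[ℝ] V} {n : V}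
    {b : OrthonormalBasis (Fin 4) ℝ V} {q : Fin 4 → ℝ} (h : IsPrincipalFrame Q n b q) (hn : n ≠ 0)
    {P : V →L[ℝ] V} {f₀ f₁ : V} (hP : IsPlaneProjection P f₀ f₁) (h0 : n - P n = 0) (m : V) :
    pairing f₀ f₁ (b 0) m = 0 := by
  have h1 := hP.norm_sub_sq n
  rw [h0, ← h.smul_eq, inner_smul_right, inner_smul_right] at h1
  have h2 : 0 < ‖n‖ := norm_pos_iff.mpr hn
  have h3 : ‖n‖ ^ 2 * (inner ℝ f₀ (b 0) ^ 2 + inner ℝ f₁ (b 0) ^ 2) = 0 := by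
    have h4 : ‖(0 : V)‖ ^ 2 = 0 := by simp
    rw [h4] at h1
    linear_combination -h1
  have h5 := (mul_eq_zero.mp h3).resolve_left (by positivity)
  have h6 : inner ℝ f₀ (b 0) = 0 := by
    nlinarith [sq_nonneg (inner ℝ f₀ (b 0)), sq_nonneg (inner ℝ f₁ (b 0))]
  have h7 : inner ℝ f₁ (b 0) = 0 := by
    nlinarith [sq_nonneg (inner ℝ f₀ (b 0)), sq_nonneg (inner ℝ f₁ (b 0))]
  simp [pairing, h6, h7]

variable [FiniteDimensional ℝ V] {K : Set V} {p : V → V} (hp : IsNearestPointMap K p)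
include hp

namespace IsNearestPointMap

/-- The map `x ↦ Pr_E y + Pr_{E^⊥} n` is injective on the points where its derivative is
invertible: by monotonicity of the normal bundle, it is constant on the segment between two points
of a fibre. -/
lemma projection_injective (hconv : Convex ℝ K) {P : V →L[ℝ] V} {f₀ f₁ : V}
    (hP : IsPlaneProjection P f₀ f₁) {x x' : V} (hd : DifferentiableAt ℝ p x)
    (hdet : (bundleDeriv p P (1 - P) x).det ≠ 0)
    (h : bundleMap p P (1 - P) x = bundleMap p P (1 - P) x') : x = x' := by
  have h1 : P (p x) = P (p x') := by
    rw [← hP.apply_bundleMap, h, hP.apply_bundleMap]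
  have h2 : (x - p x) - P (x - p x) = (x' - p x') - P (x' - p x') := by
    rw [← hP.bundleMap_sub, h, hP.bundleMap_sub]
  have h3 : P (p x' - p x) = 0 := by rw [map_sub, h1, sub_self]
  have h4 : (x' - p x') - (x - p x) = P ((x' - p x') - (x - p x)) := by
    rw [map_sub]
    have := sub_eq_sub_iff_add_eq_add.mp h2
    rw [sub_eq_sub_iff_add_eq_add]
    rw [add_comm (P (x' - p x')), this, add_comm]
  have h5 : inner ℝ ((x' - p x') - (x - p x)) (p x' - p x) = 0 := by
    rw [h4, hP.inner_comm, h3, inner_zero_right]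
  have h6 := hp.inner_le x _ (hp.mem x')
  have h7 := hp.inner_le x' _ (hp.mem x)
  have h8 : inner ℝ (x' - p x') (p x - p x') = - inner ℝ (x' - p x') (p x' - p x) := by
    rw [← inner_neg_right, neg_sub]
  rw [inner_sub_left] at h5
  have h9 : inner ℝ (x - p x) (p x' - p x) = 0 := by linarith
  have h10 : inner ℝ (x' - p x') (p x' - p x) = 0 := by linarith
  have hseg {t : ℝ} (ht : t ∈ Set.Icc (0 : ℝ) 1) :
      bundleMap p P (1 - P) (x + t • (x' - x)) = bundleMap p P (1 - P) x := by
    have hpt : p (x + t • (x' - x)) = p x + t • (p x' - p x) := by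
      refine hp.eq_of_inner_le ?_ fun z hz => ?_
      · exact hconv.add_smul_sub_mem (hp.mem x) (hp.mem x') ht
      · have e1 : x + t • (x' - x) - (p x + t • (p x' - p x)) =
          (1 - t) • (x - p x) + t • (x' - p x') := by module
        have e2 : inner ℝ (x - p x) (z - (p x + t • (p x' - p x))) ≤ 0 := by
          rw [← sub_sub, inner_sub_right, inner_smul_right, h9, mul_zero, sub_zero]
          exact hp.inner_le x z hz
        have e3 : inner ℝ (x' - p x') (z - (p x + t • (p x' - p x))) ≤ 0 := by
          have : z - (p x + t • (p x' - p x)) = (z - p x') + (1 - t) • (p x' - p x) := by module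
          rw [this, inner_add_right, inner_smul_right, h10, mul_zero, add_zero]
          exact hp.inner_le x' z hz
        rw [e1, inner_add_left, inner_smul_left, inner_smul_left]
        have := ht.1
        have := ht.2
        simp only [conj_trivial]
        nlinarith
    have e : x + t • (x' - x) - (p x + t • (p x' - p x)) =
      (x - p x) + t • ((x' - p x') - (x - p x)) := by module
    simp only [bundleMap, hpt, e, sub_apply, one_apply_eq_self]
    rw [map_add P (p x), map_smul, h3, map_add P (x - p x), map_smul, ← h4]
    module
  have hder : HasDerivAt (fun t : ℝ => bundleMap p P (1 - P) (x + t • (x' - x)))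
      (bundleDeriv p P (1 - P) x (x' - x)) 0 :=
    (hasFDerivAt_bundleMap hd P (1 - P)).hasLineDerivAt (x' - x)
  have hzero : bundleDeriv p P (1 - P) x (x' - x) = 0 := by
    have hc : HasDerivWithinAt (fun t : ℝ => bundleMap p P (1 - P) (x + t • (x' - x))) 0
        (Set.Icc 0 1) 0 :=
      (hasDerivWithinAt_const (0 : ℝ) (Set.Icc 0 1) (bundleMap p P (1 - P) x)).congr
        (fun t ht => hseg ht) (hseg ⟨le_rfl, zero_le_one⟩)
    exact ((uniqueDiffOn_Icc zero_lt_one) 0 ⟨le_rfl, zero_le_one⟩).eq_deriv _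
      hder.hasDerivWithinAt hc
  have hinj := (LinearMap.equivOfDetNeZero _ hdet).injective
  have : x' - x = 0 := hinj (by simpa using hzero)
  exact (sub_eq_zero.mp this).symm

/-- Over the relative interior of `Pr_E K`, the map `x ↦ Pr_E y + Pr_{E^⊥} n` is surjective. The
point `y` maximises `⟨w, ·⟩` in a fibre of the projection; it is obtained together with its normal
as a limit of penalised problems. -/
lemma exists_projection_eq (hK : IsCompact K) (hconv : Convex ℝ K) {P : V →L[ℝ] V} {f₀ f₁ : V}
    (hP : IsPlaneProjection P f₀ f₁) {z : V} {r : ℝ} (hr : 0 < r)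
    (hz : ∀ u, P u = u → ‖u‖ ≤ r → P z + u ∈ P '' K) : ∃ x, bundleMap p P (1 - P) x = z := by
  set w := z - P z with hw
  have hPw : P w = 0 := by rw [hw, map_sub, hP.apply_apply, sub_self]
  obtain ⟨R, hR⟩ := hK.isBounded.exists_norm_le
  have hne : K.Nonempty := ⟨p z, hp.mem z⟩
  have hR0 : 0 ≤ R := (norm_nonneg _).trans (hR _ (hp.mem z))
  have hstep (k : ℕ) : ∃ y ∈ K, ∃ ν, P ν = ν ∧ ((k : ℝ) + 1) • (P z - P y) = ν ∧
      (∀ y' ∈ K, inner ℝ (w + ν) (y' - y) ≤ 0) := by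
    set c : ℝ := (k : ℝ) + 1 with hc
    have hc0 : 0 < c := by positivity
    obtain ⟨y, hy, hmin⟩ := hK.exists_isMinOn hne
      (f := fun y => c / 2 * ‖P y - P z‖ ^ 2 - inner ℝ w y) (by fun_prop)
    refine ⟨y, hy, _, ?_, rfl, fun y' hy' => ?_⟩
    · simp [hP.apply_apply]
    have key {s : ℝ} (hs : s ∈ Set.Ioc (0 : ℝ) 1) :
        inner ℝ (w + c • (P z - P y)) (y' - y) ≤ s * (c / 2 * ‖P (y' - y)‖ ^ 2) := by
      have h1 := isMinOn_iff.mp hmin _ (hconv.add_smul_sub_mem hy hy' ⟨hs.1.le, hs.2⟩)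
      have h2 : P (y + s • (y' - y)) - P z = (P y - P z) + s • P (y' - y) := by
        rw [map_add, map_smul]; abel
      beta_reduce at h1
      rw [h2, norm_add_sq_real, inner_smul_right, norm_smul, inner_add_right, inner_smul_right,
        mul_pow, Real.norm_eq_abs, sq_abs] at h1
      have h3 : inner ℝ (P y - P z) (P (y' - y)) = - inner ℝ (P z - P y) (y' - y) := by
        rw [← hP.inner_comm, map_sub, hP.apply_apply, hP.apply_apply, ← inner_neg_left, neg_sub]
      rw [h3] at h1
      rw [inner_add_left, inner_smul_left, conj_trivial]
      have hs0 := hs.1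
      refine le_of_mul_le_mul_left ?_ hs0
      nlinarith
    have hlim : Filter.Tendsto (fun s : ℝ => s * (c / 2 * ‖P (y' - y)‖ ^ 2))
        (nhdsWithin 0 (Set.Ioi 0)) (nhds 0) := by
      have : Continuous fun s : ℝ => s * (c / 2 * ‖P (y' - y)‖ ^ 2) := by fun_prop
      have h := this.tendsto 0
      rw [zero_mul] at h
      exact h.mono_left nhdsWithin_le_nhds
    refine ge_of_tendsto hlim ?_
    filter_upwards [Ioc_mem_nhdsGT (zero_lt_one' ℝ)] with s hs using key hs
  choose y hy ν hPν hν hvar using hstep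
  -- The multipliers `ν k` stay bounded since `Pr_E z` is an interior point.
  have hbound (k : ℕ) : ‖ν k‖ ≤ ‖w‖ * (2 * R) / r := by
    rw [le_div_iff₀ hr]
    rcases eq_or_ne (ν k) 0 with h0 | h0
    · rw [h0, norm_zero, zero_mul]; positivity
    have hn0 : 0 < ‖ν k‖ := norm_pos_iff.mpr h0
    set u := (r / ‖ν k‖) • ν k with hu
    obtain ⟨y', hy', hy'z⟩ := hz u (by rw [hu, map_smul, hPν])
      (by rw [hu, norm_smul, norm_div, norm_norm, div_mul_cancel₀ _ hn0.ne', Real.norm_eq_abs,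
        abs_of_pos hr])
    have h1 := hvar k y' hy'
    have h2 : inner ℝ (ν k) (y' - y k) = inner ℝ (ν k) (P z - P (y k)) + r * ‖ν k‖ := by
      conv_lhs => rw [← hPν k, hP.inner_comm, map_sub, hy'z]
      rw [add_sub_right_comm, inner_add_right, hu, inner_smul_right, real_inner_self_eq_norm_sq]
      field_simp
    have h3 : 0 ≤ inner ℝ (ν k) (P z - P (y k)) := by
      rw [← hν k, inner_smul_left, conj_trivial]
      exact mul_nonneg (by positivity) real_inner_self_nonneg
    have h4 : -(‖w‖ * (2 * R)) ≤ inner ℝ w (y' - y k) := by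
      have h5 := neg_le_of_abs_le (abs_real_inner_le_norm w (y' - y k))
      have h6 : ‖y' - y k‖ ≤ 2 * R := by
        have := _root_.norm_sub_le y' (y k)
        linarith [hR _ hy', hR _ (hy k)]
      have := mul_le_mul_of_nonneg_left h6 (norm_nonneg w)
      linarith
    rw [inner_add_left] at h1
    linarith
  obtain ⟨⟨y₀, ν₀⟩, hmem, φ, hφ, hconvφ⟩ :=
    (hK.prod (isCompact_closedBall (0 : V) (‖w‖ * (2 * R) / r))).tendsto_subseq
      (x := fun k => (y k, ν k)) fun k => ⟨hy k, by simpa using hbound k⟩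
  have hy₀ : Filter.Tendsto (fun k => y (φ k)) Filter.atTop (nhds y₀) :=
    (continuous_fst.tendsto _).comp hconvφ
  have hν₀ : Filter.Tendsto (fun k => ν (φ k)) Filter.atTop (nhds ν₀) :=
    (continuous_snd.tendsto _).comp hconvφ
  have hPν₀ : P ν₀ = ν₀ := by
    refine tendsto_nhds_unique ((P.continuous.tendsto _).comp hν₀) (hν₀.congr fun k => ?_)
    simp [hPν]
  have hPy₀ : P y₀ = P z := by
    have h1 : Filter.Tendsto (fun k => P z - P (y (φ k))) Filter.atTop (nhds (P z - P y₀)) :=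
      tendsto_const_nhds.sub ((P.continuous.tendsto _).comp hy₀)
    have h2 : Filter.Tendsto (fun k => ((φ k : ℝ) + 1)⁻¹ • ν (φ k)) Filter.atTop
        (nhds ((0 : ℝ) • ν₀)) := by
      refine Filter.Tendsto.smul ?_ hν₀
      refine Filter.Tendsto.comp (g := fun x : ℝ => x⁻¹) tendsto_inv_atTop_zero ?_
      exact Filter.tendsto_atTop_add_const_right _ _
        (tendsto_natCast_atTop_atTop.comp hφ.tendsto_atTop)
    have h3 := tendsto_nhds_unique h1 (h2.congr fun k => by
      rw [← hν, smul_smul, inv_mul_cancel₀ (by positivity), one_smul])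
    rw [zero_smul] at h3
    exact (sub_eq_zero.mp h3).symm
  have hp₀ : p (y₀ + (w + ν₀)) = y₀ := by
    refine hp.eq_of_inner_le hmem.1 fun y' hy' => ?_
    rw [add_sub_cancel_left]
    refine le_of_tendsto ((tendsto_const_nhds.add hν₀).inner (tendsto_const_nhds.sub hy₀))
      (Filter.Eventually.of_forall fun k => hvar (φ k) y' hy')
  refine ⟨y₀ + (w + ν₀), ?_⟩
  simp only [bundleMap, hp₀, add_sub_cancel_left]
  simp [hPy₀, hPν₀, hPw]
  simp [hw]

end IsNearestPointMap
end Projection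

/-! ### Areas of projections as integrals over the complement -/

section ProjectionArea

variable {V : Type*} [NormedAddCommGroup V] [InnerProductSpace ℝ V]

/-- The Jacobian of the map `x ↦ Pr_E y + Pr_{E^⊥} n` of the normal bundle. -/
def projJacobian (p : V → V) (P : V →L[ℝ] V) (x : V) : ℝ := (bundleDeriv p P (1 - P) x).det

lemma IsPrincipalFrame.projJacobian_eq {p : V → V} {x : V} {b : OrthonormalBasis (Fin 4) ℝ V}
    {q : Fin 4 → ℝ} (h : IsPrincipalFrame (fderiv ℝ p x) (x - p x) b q) {P : V →L[ℝ] V} {f₀ f₁ : V}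
    (hP : IsPlaneProjection P f₀ f₁) :
    projJacobian p P x = (1 - q 1) * q 2 * q 3 * pairing f₀ f₁ (b 0) (b 1) +
        (1 - q 2) * q 1 * q 3 * pairing f₀ f₁ (b 0) (b 2) +
        (1 - q 3) * q 1 * q 2 * pairing f₀ f₁ (b 0) (b 3) := by
  have := h.det_projection hP 1
  rwa [one_smul, one_pow, one_mul] at this

lemma IsPrincipalFrame.projJacobian_nonneg {p : V → V} {x : V} {b : OrthonormalBasis (Fin 4) ℝ V}
    {q : Fin 4 → ℝ} (h : IsPrincipalFrame (fderiv ℝ p x) (x - p x) b q) {P : V →L[ℝ] V} {f₀ f₁ : V}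
    (hP : IsPlaneProjection P f₀ f₁) : 0 ≤ projJacobian p P x := by
  have h1 := h.nonneg
  have h2 := fun i => sub_nonneg.mpr (h.le_one i)
  have h3 (m : V) : 0 ≤ pairing f₀ f₁ (b 0) m := sq_nonneg _
  rw [h.projJacobian_eq hP]
  exact add_nonneg (add_nonneg
    (mul_nonneg (mul_nonneg (mul_nonneg (h2 1) (h1 2)) (h1 3)) (h3 _))
    (mul_nonneg (mul_nonneg (mul_nonneg (h2 2) (h1 1)) (h1 3)) (h3 _)))
    (mul_nonneg (mul_nonneg (mul_nonneg (h2 3) (h1 1)) (h1 2)) (h3 _))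

variable [FiniteDimensional ℝ V] [MeasurableSpace V] [BorelSpace V]

lemma measurable_projJacobian (p : V → V) (P : V →L[ℝ] V) : Measurable (projJacobian p P) :=
  measurable_bundleDeriv p P (1 - P)

/-- The volume of the product of a set in a plane `E` and the unit disc of `E^⊥`. -/
lemma volume_preimage_prod (E : Submodule ℝ V) (A : Set E) (B : Set Eᗮ) (hA : MeasurableSet A)
    (hB : MeasurableSet B) :
    volume {z | E.orthogonalProjectionOnto z ∈ A ∧ Eᗮ.orthogonalProjectionOnto z ∈ B} =
      volume A * volume B := by
  have h := (WithLp.volume_preserving_ofLp E Eᗮ).comp E.orthogonalDecomposition.measurePreserving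
  rw [← Measure.prod_prod, ← Measure.volume_eq_prod, ← h.measure_preimage
    (hA.prod hB).nullMeasurableSet]
  congr 1
  ext z
  simp

variable {K : Set V} {p : V → V} (hp : IsNearestPointMap K p)
include hp

namespace IsNearestPointMap

/-- The map `x ↦ Pr_E y + Pr_{E^⊥} n` covers the product of `Pr_E K` and the unit disc of `E^⊥`
once, up to null sets: the images of `K`, of the points without derivative and of the critical
points are null, and so is the part over the boundary of `Pr_E K`. -/
lemma lintegral_projJacobian (hK : IsCompact K) (hconv : Convex ℝ K)
    (hV : Module.finrank ℝ V = 4) {E : Submodule ℝ V} (hE : Module.finrank ℝ E = 2) {f₀ f₁ : V}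
    (hP : IsPlaneProjection E.starProjection f₀ f₁) :
    ∫⁻ x in Kᶜ, ENNReal.ofReal (projJacobian p E.starProjection x) *
      Set.indicator {v | ‖v - E.starProjection v‖ ≤ 1} 1 (x - p x) =
      volume (E.orthogonalProjectionOnto '' K) * ENNReal.ofReal (unitBallVolume 2) := by
  set P : V →L[ℝ] V := E.starProjection with hPdef
  set Ψ := bundleMap p P (1 - P) with hΨ
  set R := {x | DifferentiableAt ℝ p x} with hR
  have hRae : volume Rᶜ = 0 := hp.ae_differentiableAt
  have hKm := hK.isClosed.measurableSet.compl
  set D : Set V := {v | ‖v - P v‖ ≤ 1} with hD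
  have hDm : MeasurableSet D :=
    measurableSet_le (by fun_prop) measurable_const
  set G := Kᶜ ∩ R ∩ {x | projJacobian p P x ≠ 0} with hG
  have hGm : MeasurableSet G :=
    (hKm.inter (measurableSet_of_differentiableAt ℝ p)).inter
      ((measurable_projJacobian p P) (measurableSet_singleton 0).compl)
  -- The Jacobian vanishes off `G`.
  have h1 : ∫⁻ x in Kᶜ, ENNReal.ofReal (projJacobian p P x) * D.indicator 1 (x - p x) =
      ∫⁻ x in G, ENNReal.ofReal |(bundleDeriv p P (1 - P) x).det| * D.indicator 1 (Ψ x) := by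
    rw [← lintegral_indicator hGm, ← lintegral_indicator hKm]
    refine lintegral_congr_ae ?_
    filter_upwards [hp.ae_differentiableAt] with x hx
    by_cases hxK : x ∈ K
    · rw [Set.indicator_of_notMem (show x ∉ Kᶜ from fun h => h hxK),
        Set.indicator_of_notMem (show x ∉ G from fun h => h.1.1 hxK)]
    · rw [Set.indicator_of_mem (show x ∈ Kᶜ from hxK)]
      obtain ⟨b, q, hf⟩ := hp.exists_frame hV hxK hx
      have hmem : Ψ x ∈ D ↔ x - p x ∈ D := by
        simp only [hD, Set.mem_ofPred_eq, hΨ, hP.bundleMap_sub]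
      by_cases h0 : projJacobian p P x = 0
      · rw [Set.indicator_of_notMem (show x ∉ G from fun h => h.2 h0), h0]; simp
      · rw [Set.indicator_of_mem (show x ∈ G from ⟨⟨hxK, hx⟩, h0⟩)]
        congr 1
        · exact congrArg _ (abs_of_nonneg (hf.projJacobian_nonneg hP)).symm
        · by_cases hm : x - p x ∈ D
          · rw [Set.indicator_of_mem hm, Set.indicator_of_mem (hmem.mpr hm)]; rfl
          · rw [Set.indicator_of_notMem hm, Set.indicator_of_notMem (fun h => hm (hmem.mp h))]
  have hinj : Set.InjOn Ψ G := fun x hx x' _ h =>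
    hp.projection_injective hconv hP hx.1.2 hx.2 h
  rw [h1, ← lintegral_image_eq_lintegral_abs_det_fderiv_mul volume hGm
    (fun x hx => (hasFDerivAt_bundleMap hx.1.2 _ _).hasFDerivWithinAt) hinj,
    lintegral_indicator_one hDm, Measure.restrict_apply hDm]
  set A := E.orthogonalProjectionOnto '' K with hA
  have hAc : IsCompact A := hK.image E.orthogonalProjectionOnto.continuous
  have hAconv : Convex ℝ A := hconv.linear_image E.orthogonalProjectionOnto.toLinearMap
  have hfr : Module.finrank ℝ Eᗮ = 2 := by
    have := E.finrank_add_finrank_orthogonal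
    omega
  have hball : volume (Metric.closedBall (0 : Eᗮ) 1) = ENNReal.ofReal (unitBallVolume 2) := by
    have : Nontrivial Eᗮ := Module.nontrivial_of_finrank_pos (R := ℝ) (by omega)
    rw [unitBallVolume, measureReal_def, ENNReal.ofReal_toReal measure_closedBall_lt_top.ne,
      InnerProductSpace.volume_closedBall, InnerProductSpace.volume_closedBall, hfr]
    simp
  have hperp (z : V) : Eᗮ.orthogonalProjectionOnto z ∈ Metric.closedBall (0 : Eᗮ) 1 ↔ z ∈ D := by
    rw [mem_closedBall_zero_iff]
    change ‖(Eᗮ.orthogonalProjectionOnto z : V)‖ ≤ 1 ↔ _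
    have : (Eᗮ.orthogonalProjectionOnto z : V) = z - P z := by
      simp [hPdef]
    rw [this]; rfl
  rw [← hball, ← volume_preimage_prod E A _ hAc.isClosed.measurableSet
    Metric.isClosed_closedBall.measurableSet]
  simp only [hperp]
  apply measure_congr
  have hsub : D ∩ Ψ '' G ⊆ {z | E.orthogonalProjectionOnto z ∈ A ∧ z ∈ D} := by
    rintro _ ⟨hz, x, _, rfl⟩
    refine ⟨⟨p x, hp.mem x, Subtype.ext ?_⟩, hz⟩
    exact (hP.apply_bundleMap p x).symm
  refine (LE.le.eventuallyLE hsub).antisymm ?_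
  rw [ae_le_set]
  have hnull1 : volume (Ψ '' K) = 0 := by
    refine measure_mono_null ?_ (Measure.addHaar_submodule volume E ?_)
    · rintro _ ⟨x, hx, rfl⟩
      rw [hΨ, bundleMap, hp.mem_iff.mp hx, map_zero, add_zero]
      exact Submodule.starProjection_apply_mem _ _
    · rintro rfl
      rw [finrank_top] at hE
      omega
  have hnull2 : volume (Ψ '' Rᶜ) = 0 := by
    obtain ⟨C, hC⟩ := lipschitzWith_bundleMap hp.lipschitzWith P (1 - P)
    exact volume_image_eq_zero_of_lipschitzWith hC hRae
  have hnull3 : volume (Ψ '' (R ∩ {x | projJacobian p P x = 0})) = 0 :=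
    addHaar_image_eq_zero_of_det_fderivWithin_eq_zero volume
      (fun x hx => (hasFDerivAt_bundleMap hx.1 _ _).hasFDerivWithinAt) fun x hx => hx.2
  have hnull4 : volume {z | E.orthogonalProjectionOnto z ∈ frontier A ∧
      Eᗮ.orthogonalProjectionOnto z ∈ Metric.closedBall (0 : Eᗮ) 1} = 0 := by
    rw [volume_preimage_prod E _ _ isClosed_frontier.measurableSet
      Metric.isClosed_closedBall.measurableSet, hAconv.addHaar_frontier volume, zero_mul]
  refine measure_mono_null ?_ (measure_union_null (measure_union_null hnull1 hnull2)
    (measure_union_null hnull3 hnull4))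
  rintro z ⟨⟨hzA, hzD⟩, hz⟩
  by_cases hint : E.orthogonalProjectionOnto z ∈ interior A
  · obtain ⟨r, hr, hball⟩ := Metric.mem_nhds_iff.mp (mem_interior_iff_mem_nhds.mp hint)
    obtain ⟨x, hx⟩ := hp.exists_projection_eq hK hconv hP (z := z) (half_pos hr) (by
      intro u hu hur
      have huE : u ∈ E := Submodule.starProjection_eq_self_iff.mp hu
      obtain ⟨y, hy, hyz⟩ := hball (show E.orthogonalProjectionOnto z + ⟨u, huE⟩ ∈ _ by
        rw [mem_ball_iff_norm, add_sub_cancel_left]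
        exact lt_of_le_of_lt hur (half_lt_self hr))
      exact ⟨y, hy, congrArg Subtype.val hyz⟩)
    by_cases hxK : x ∈ K
    · exact Or.inl (Or.inl ⟨x, hxK, hx⟩)
    by_cases hxR : x ∈ R
    · by_cases h0 : projJacobian p P x = 0
      · exact Or.inr (Or.inl ⟨x, ⟨hxR, h0⟩, hx⟩)
      · exact absurd ⟨hzD, x, ⟨⟨hxK, hxR⟩, h0⟩, hx⟩ hz
    · exact Or.inl (Or.inr ⟨x, hxR, hx⟩)
  · refine Or.inr (Or.inr ⟨?_, (hperp z).mpr hzD⟩)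
    exact ⟨subset_closure hzA, hint⟩

/-- The Jacobian of the projection is homogeneous along the dilations of the normal bundle. -/
lemma lintegral_projJacobian_dilation (hK : IsClosed K) (hV : Module.finrank ℝ V = 4)
    {P : V →L[ℝ] V} {f₀ f₁ : V} (hP : IsPlaneProjection P f₀ f₁) {t : ℝ} (ht : 0 < t)
    (k : V → ENNReal) :
    ∫⁻ x in Kᶜ, ENNReal.ofReal (projJacobian p P x) * k (x - p x) =
      ENNReal.ofReal (t ^ 2) *
        ∫⁻ x in Kᶜ, ENNReal.ofReal (projJacobian p P x) * k (t • (x - p x)) := by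
  rw [hp.lintegral_dilation hK ht, ← lintegral_const_mul' _ _ ENNReal.ofReal_ne_top]
  refine lintegral_congr_ae ?_
  have hae : ∀ᵐ x, DifferentiableAt ℝ p (bundleMap p 1 (t • 1) x) :=
    hp.volume_dilation_preimage ht hp.ae_differentiableAt
  filter_upwards [ae_restrict_of_ae hae, hp.ae_compl hK (q := fun x => x ∉ K ∧
    DifferentiableAt ℝ p x) fun x h h' => ⟨h, h'⟩] with x hσ hx
  obtain ⟨b, q, hf⟩ := hp.exists_frame hV hx.1 hx.2
  obtain ⟨b', q', hf'⟩ := hp.exists_frame hV (hp.dilation_notMem hx.1 ht) hσ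
  have hchain : bundleDeriv p P (1 - P) (bundleMap p 1 (t • 1) x) * bundleDeriv p 1 (t • 1) x =
      bundleDeriv p P (t • (1 - P)) x := by
    have h1 := (hasFDerivAt_bundleMap hσ P (1 - P)).comp x (hasFDerivAt_bundleMap hx.2 1 (t • 1))
    have h2 := hasFDerivAt_bundleMap hx.2 P (t • (1 - P))
    have h3 : bundleMap p P (1 - P) ∘ bundleMap p 1 (t • 1) = bundleMap p P (t • (1 - P)) := by
      ext y : 1
      rw [Function.comp, bundleMap, hp.dilation_sub y ht.le, hp.apply_dilation y ht.le]
      simp [bundleMap]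
    rw [h3] at h1
    exact h1.unique h2
  have hdet : projJacobian p P (bundleMap p 1 (t • 1) x) * (bundleDeriv p 1 (t • 1) x).det =
      t ^ 2 * projJacobian p P x := by
    rw [hf.projJacobian_eq hP, ← hf.det_projection hP t]
    change _ = (bundleDeriv p P (t • (1 - P)) x).det
    rw [← hchain]
    exact (LinearMap.det_comp _ _).symm
  have hnn : 0 ≤ (bundleDeriv p 1 (t • 1) x).det := by
    have : (bundleDeriv p 1 (t • 1) x).det = _ := hf.det_dilation t
    rw [this]
    exact Finset.prod_nonneg fun i _ =>
      add_nonneg (hf.nonneg i) (mul_nonneg ht.le (sub_nonneg.mpr (hf.le_one i)))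
  rw [hp.dilation_sub x ht.le, abs_of_nonneg hnn, ← mul_assoc, ← mul_assoc,
    ← ENNReal.ofReal_mul hnn, mul_comm _ (projJacobian p P _), hdet,
    ENNReal.ofReal_mul (by positivity)]

end IsNearestPointMap
end ProjectionArea

/-! ### Areas of projections as integrals over the shell -/

section ShellFormula

lemma lintegral_Ioi_id_indicator {b : ℝ} (hb : 0 < b) :
    ∫⁻ t in Set.Ioi (0 : ℝ), ENNReal.ofReal t * Set.indicator {t | t * b ≤ 1} 1 t =
      ENNReal.ofReal (1 / (2 * b ^ 2)) := by
  have h1 : ∫⁻ t in Set.Ioi (0 : ℝ), ENNReal.ofReal t * Set.indicator {t | t * b ≤ 1} 1 t =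
      ∫⁻ t in Set.Ioc (0 : ℝ) b⁻¹, ENNReal.ofReal t := by
    rw [← lintegral_indicator measurableSet_Ioi, ← lintegral_indicator measurableSet_Ioc]
    congr 1
    ext t
    have h2 : t * b ≤ 1 ↔ t ≤ b⁻¹ := by rw [inv_eq_one_div, le_div_iff₀ hb]
    by_cases h0 : 0 < t <;> by_cases h3 : t ≤ b⁻¹ <;> simp [Set.indicator, h0, h2, h3]
  have hb' : (0 : ℝ) ≤ b⁻¹ := by positivity
  rw [h1, ← ofReal_integral_eq_lintegral_ofReal,
    ← intervalIntegral.integral_of_le hb', integral_id]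
  · congr 1; field_simp; ring
  · exact (intervalIntegrable_iff_integrableOn_Ioc_of_le hb').mp
      (continuous_id.intervalIntegrable _ _)
  · filter_upwards [ae_restrict_mem measurableSet_Ioc] with t ht using ht.1.le

lemma lintegral_Ioi_inv_indicator {a : ℝ} (ha : 0 < a) :
    ∫⁻ t in Set.Ioi (0 : ℝ), ENNReal.ofReal t⁻¹ *
      (ENNReal.ofReal ((t⁻¹ * a) ^ 2) * Set.indicator {t | t⁻¹ * a ≤ 1} 1 t) =
      ENNReal.ofReal (1 / 2) := by
  have h1 : ∫⁻ t in Set.Ioi (0 : ℝ), ENNReal.ofReal t⁻¹ *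
      (ENNReal.ofReal ((t⁻¹ * a) ^ 2) * Set.indicator {t | t⁻¹ * a ≤ 1} 1 t) =
      ∫⁻ t in Set.Ici a, ENNReal.ofReal (a ^ 2 * t ^ (-3 : ℝ)) := by
    rw [← lintegral_indicator measurableSet_Ioi, ← lintegral_indicator measurableSet_Ici]
    congr 1
    ext t
    by_cases h0 : 0 < t
    · have h2 : t⁻¹ * a ≤ 1 ↔ a ≤ t := by rw [inv_mul_le_iff₀ h0, mul_one]
      by_cases h3 : a ≤ t
      · simp only [Set.indicator, Set.mem_Ioi, h0, Set.mem_ofPred_eq, h2, h3, Set.mem_Ici, if_true,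
          Pi.one_apply, mul_one]
        rw [← ENNReal.ofReal_mul (by positivity)]
        congr 1
        rw [Real.rpow_neg h0.le]
        norm_cast
        field_simp
      · simp [Set.indicator, h0, h2, h3]
    · have h3 : ¬ a ≤ t := fun h => h0 (ha.trans_le h)
      simp [Set.indicator, h0, h3]
  rw [h1, setLIntegral_congr Ioi_ae_eq_Ici.symm, ← ofReal_integral_eq_lintegral_ofReal,
    integral_const_mul, integral_Ioi_rpow_of_lt (by norm_num) ha]
  · congr 1
    norm_num
    field_simp
  · exact (integrableOn_Ioi_rpow_of_lt (by norm_num) ha).const_mul _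
  · filter_upwards [ae_restrict_mem measurableSet_Ioi] with t ht
    have : 0 < t := ha.trans ht
    simp only [Pi.zero_apply]
    positivity

variable {V : Type*} [NormedAddCommGroup V] [InnerProductSpace ℝ V] [FiniteDimensional ℝ V]
  [MeasurableSpace V] [BorelSpace V] {K : Set V} {p : V → V} (hp : IsNearestPointMap K p)
include hp

namespace IsNearestPointMap

/-- The area of the projection of `K` to a plane, as an integral over the shell around `K` whose
domain of integration does not depend on the plane. It follows from `lintegral_projJacobian` by
Tonelli's theorem for an additional dilation factor: the measure with density `projJacobian` is
homogeneous under dilations, so the cutoff `|Pr_{E^⊥} n| ≤ 1` can be exchanged for `|n| ≤ 1`. -/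
lemma lintegral_shell_projJacobian (hK : IsCompact K) (hconv : Convex ℝ K)
    (hV : Module.finrank ℝ V = 4) {E : Submodule ℝ V} (hE : Module.finrank ℝ E = 2) {f₀ f₁ : V}
    (hP : IsPlaneProjection E.starProjection f₀ f₁) :
    ∫⁻ x in Kᶜ ∩ {x | ‖x - p x‖ ≤ 1}, ENNReal.ofReal (projJacobian p E.starProjection x *
      (‖x - p x‖ ^ 2 / ‖(x - p x) - E.starProjection (x - p x)‖ ^ 2)) =
      volume (E.orthogonalProjectionOnto '' K) * ENNReal.ofReal (unitBallVolume 2) := by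
  rw [← hp.lintegral_projJacobian hK hconv hV hE hP]
  set P : V →L[ℝ] V := E.starProjection with hPdef
  have hKm := hK.isClosed.measurableSet.compl
  have hnm : Measurable fun x => x - p x :=
    measurable_id.sub hp.lipschitzWith.continuous.measurable
  have hJ := (measurable_projJacobian p P).ennreal_ofReal
  let F : V → ENNReal := fun v => ENNReal.ofReal (‖v‖ ^ 2) * Set.indicator {v | ‖v‖ ≤ 1} 1 v
  let G : V → ENNReal := Set.indicator {v | ‖v - P v‖ ≤ 1} 1
  have hF : Measurable F := by
    refine Measurable.mul (by fun_prop) (measurable_one.indicator ?_)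
    exact measurableSet_le measurable_norm measurable_const
  have hG : Measurable G := by
    refine measurable_one.indicator ?_
    exact measurableSet_le (by fun_prop) measurable_const
  -- Both sides are evaluations of one double integral over `x` and a dilation factor `t`.
  have step1 : ∫⁻ x in Kᶜ ∩ {x | ‖x - p x‖ ≤ 1}, ENNReal.ofReal (projJacobian p P x *
      (‖x - p x‖ ^ 2 / ‖(x - p x) - P (x - p x)‖ ^ 2)) = 2 * ∫⁻ x in Kᶜ, ∫⁻ t in Set.Ioi (0 : ℝ),
        ENNReal.ofReal (projJacobian p P x) * F (x - p x) *
          (ENNReal.ofReal t * G (t • (x - p x))) := by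
    rw [← lintegral_const_mul' _ _ ENNReal.ofNat_ne_top, Set.inter_comm,
      ← Measure.restrict_restrict (measurableSet_shell hp 1),
      ← lintegral_indicator (measurableSet_shell hp 1)]
    refine lintegral_congr_ae (hp.ae_compl hK.isClosed fun x hx hd => ?_)
    obtain ⟨b, q, hf⟩ := hp.exists_frame hV hx hd
    have hn : x - p x ≠ 0 := fun h => hx (hp.mem_iff.mpr h)
    have hJ0 := hf.projJacobian_eq hP
    have hJnn := hf.projJacobian_nonneg hP
    rcases eq_or_ne (x - p x - P (x - p x)) 0 with hb | hb
    · simp only [hf.pairing_zero_of_sub_eq_zero hn hP hb, mul_zero, add_zero] at hJ0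
      simp [hJ0, Set.indicator]
    · have hb' : 0 < ‖x - p x - P (x - p x)‖ := norm_pos_iff.mpr hb
      have hm : Measurable fun t : ℝ => ENNReal.ofReal t * G (t • (x - p x)) :=
        Measurable.mul (by fun_prop) (hG.comp (by fun_prop))
      have hint : ∫⁻ t in Set.Ioi (0 : ℝ), ENNReal.ofReal t * G (t • (x - p x)) =
          ENNReal.ofReal (1 / (2 * ‖x - p x - P (x - p x)‖ ^ 2)) := by
        rw [← lintegral_Ioi_id_indicator hb']
        refine setLIntegral_congr_fun measurableSet_Ioi fun t ht => ?_
        have ht : 0 < t := ht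
        simp only [G, Set.indicator, Set.mem_ofPred_eq, map_smul, ← smul_sub, norm_smul,
          Real.norm_eq_abs, abs_of_pos ht, Pi.one_apply]
      beta_reduce
      rw [lintegral_const_mul _ hm, hint]
      by_cases h1 : ‖x - p x‖ ≤ 1
      · simp only [F, Set.indicator, Set.mem_ofPred_eq, h1, if_true, Pi.one_apply, mul_one]
        rw [show (2 : ENNReal) = ENNReal.ofReal 2 by simp, ← ENNReal.ofReal_mul hJnn,
          ← ENNReal.ofReal_mul (by positivity), ← ENNReal.ofReal_mul zero_le_two]
        congr 1
        field_simp
      · simp [F, Set.indicator, h1]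
  have step2 (t : ℝ) (ht : 0 < t) :
      ∫⁻ x in Kᶜ, ENNReal.ofReal (projJacobian p P x) * F (x - p x) *
          (ENNReal.ofReal t * G (t • (x - p x))) =
      ∫⁻ x in Kᶜ, ENNReal.ofReal (projJacobian p P x) * G (x - p x) *
          (ENNReal.ofReal t⁻¹ * F (t⁻¹ • (x - p x))) := by
    have h := hp.lintegral_projJacobian_dilation hK.isClosed hV hP ht
      (fun v => F (t⁻¹ • v) * G v)
    simp only [smul_smul, inv_mul_cancel₀ ht.ne', one_smul] at h
    calc _ = ENNReal.ofReal t * ∫⁻ x in Kᶜ, ENNReal.ofReal (projJacobian p P x) *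
          (F (x - p x) * G (t • (x - p x))) := by
            rw [← lintegral_const_mul' _ _ ENNReal.ofReal_ne_top]
            congr 1; ext x; ring
      _ = ENNReal.ofReal t⁻¹ * ∫⁻ x in Kᶜ, ENNReal.ofReal (projJacobian p P x) *
          (F (t⁻¹ • (x - p x)) * G (x - p x)) := by
            rw [h, ← mul_assoc, ← ENNReal.ofReal_mul (by positivity)]
            congr 2; field_simp
      _ = _ := by
            rw [← lintegral_const_mul' _ _ ENNReal.ofReal_ne_top]
            congr 1; ext x; ring
  have step3 : ∫⁻ x in Kᶜ, ∫⁻ t in Set.Ioi (0 : ℝ),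
        ENNReal.ofReal (projJacobian p P x) * G (x - p x) *
          (ENNReal.ofReal t⁻¹ * F (t⁻¹ • (x - p x))) = ENNReal.ofReal (1 / 2) *
      ∫⁻ x in Kᶜ, ENNReal.ofReal (projJacobian p P x) * G (x - p x) := by
    rw [← lintegral_const_mul' _ _ ENNReal.ofReal_ne_top]
    refine setLIntegral_congr_fun hKm fun x hx => ?_
    have hn : x - p x ≠ 0 := fun h => hx (hp.mem_iff.mpr h)
    have hm : Measurable fun t : ℝ => ENNReal.ofReal t⁻¹ * F (t⁻¹ • (x - p x)) := by
      refine Measurable.mul (by fun_prop) (hF.comp (by fun_prop))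
    rw [lintegral_const_mul _ hm, mul_comm, ← lintegral_Ioi_inv_indicator (norm_pos_iff.mpr hn)]
    congr 1
    refine setLIntegral_congr_fun measurableSet_Ioi fun t ht => ?_
    have ht : 0 < t := ht
    simp only [F, Set.indicator, Set.mem_ofPred_eq, norm_smul, norm_inv, Real.norm_eq_abs,
      abs_of_pos ht, Pi.one_apply]
  have hm1 : Measurable fun z : V × ℝ => ENNReal.ofReal (projJacobian p P z.1) * F (z.1 - p z.1) *
      (ENNReal.ofReal z.2 * G (z.2 • (z.1 - p z.1))) := by
    refine ((hJ.comp measurable_fst).mul (hF.comp (hnm.comp measurable_fst))).mul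
      (measurable_snd.ennreal_ofReal.mul (hG.comp (measurable_snd.smul (hnm.comp measurable_fst))))
  have hm2 : Measurable fun z : ℝ × V => ENNReal.ofReal (projJacobian p P z.2) * G (z.2 - p z.2) *
      (ENNReal.ofReal z.1⁻¹ * F (z.1⁻¹ • (z.2 - p z.2))) := by
    refine ((hJ.comp measurable_snd).mul (hG.comp (hnm.comp measurable_snd))).mul
      (measurable_fst.inv.ennreal_ofReal.mul
        (hF.comp (measurable_fst.inv.smul (hnm.comp measurable_snd))))
  rw [step1, lintegral_lintegral_swap hm1.aemeasurable,
    setLIntegral_congr_fun measurableSet_Ioi step2, lintegral_lintegral_swap hm2.aemeasurable,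
    step3, ← mul_assoc]
  have h2 : (2 : ENNReal) * ENNReal.ofReal (1 / 2) = 1 := by
    rw [show (2 : ENNReal) = ENNReal.ofReal 2 by simp, ← ENNReal.ofReal_mul zero_le_two]
    norm_num
  rw [h2, one_mul]

end IsNearestPointMap
end ShellFormula

/-! ### Averages over the unitary group -/

section UnitaryAverages

instance : haarU2.IsMulLeftInvariant := by unfold haarU2; infer_instance

lemma norm_act (g : U2) (x : C2) : ‖act g x‖ = ‖x‖ := by
  have h := congrArg Complex.re (inner_act g x x)
  rw [← inner_real_eq, ← inner_real_eq, real_inner_self_eq_norm_sq, real_inner_self_eq_norm_sq] at h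
  exact (sq_eq_sq₀ (norm_nonneg _) (norm_nonneg _)).mp h

lemma inner_real_act (g : U2) (x y : C2) : inner ℝ (act g x) (act g y) = inner ℝ x y := by
  rw [inner_real_eq, inner_act, ← inner_real_eq]

lemma inner_real_act_left (g : U2) (x y : C2) : inner ℝ (act g x) y = inner ℝ x (act g⁻¹ y) := by
  rw [← inner_real_act g x, ← act_mul, mul_inv_cancel, act_one]

lemma measurePreserving_act (g : U2) : MeasurePreserving (act g) := by
  let e : C2 →ₗᵢ[ℝ] C2 := ⟨act g, norm_act g⟩
  exact (e.toLinearIsometryEquiv rfl).measurePreserving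

/-- `U(2)` acts transitively on the unit sphere. -/
lemma exists_act_eq {n : C2} (hn : ‖n‖ = 1) : ∃ u : U2, act u !₂[1, 0] = n := by
  have c1 : inner ℂ n n = (1 : ℂ) := by rw [inner_self_eq_norm_sq_to_K, hn]; simp
  rw [PiLp.inner_apply, Fin.sum_univ_two] at c1
  simp only [RCLike.inner_apply] at c1
  let M : Matrix (Fin 2) (Fin 2) ℂ :=
    !![n 0, - (starRingEnd ℂ) (n 1); n 1, (starRingEnd ℂ) (n 0)]
  have hM : M ∈ Matrix.unitaryGroup (Fin 2) ℂ := by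
    rw [Matrix.mem_unitaryGroup_iff']
    ext i j
    fin_cases i <;> fin_cases j <;> simp [M, Matrix.mul_apply, Fin.sum_univ_two] <;>
      first | linear_combination c1 | ring
  refine ⟨⟨M, hM⟩, ?_⟩
  ext i
  fin_cases i <;> simp [act_apply, M, Matrix.toLpLin_apply]

lemma act_mk (h : U2) (z w : ℂ) :
    act h !₂[z, w] = !₂[h.1 0 0 * z + h.1 0 1 * w, h.1 1 0 * z + h.1 1 1 * w] := by
  ext i
  fin_cases i <;> simp [act_apply, Matrix.toLpLin_apply]

/-- The unitary matrix `diag(1, ζ)`. -/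
def diagUnitary (ζ : ℂ) (hζ : ‖ζ‖ = 1) : U2 :=
  ⟨!![1, 0; 0, ζ], by
    rw [Matrix.mem_unitaryGroup_iff']
    have : (starRingEnd ℂ) ζ * ζ = 1 := by rw [Complex.conj_mul', hζ]; simp
    ext i j
    fin_cases i <;> fin_cases j <;> simp [Matrix.mul_apply, Fin.sum_univ_two, this]⟩

lemma act_diagUnitary (ζ : ℂ) (hζ : ‖ζ‖ = 1) (z w : ℂ) :
    act (diagUnitary ζ hζ) !₂[z, w] = !₂[z, ζ * w] := by
  rw [act_mk]; simp [diagUnitary]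

lemma lintegral_act_inv (F : C2 → ENNReal) (u : U2) (x : C2) :
    ∫⁻ g, F (act g⁻¹ (act u x)) ∂haarU2 = ∫⁻ g, F (act g⁻¹ x) ∂haarU2 := by
  rw [← lintegral_mul_left_eq_self (μ := haarU2) (fun g => F (act g⁻¹ x)) u⁻¹]
  simp [act_mul]

lemma continuous_act_inv (x : C2) : Continuous fun g : U2 => act g⁻¹ x :=
  continuous_act.comp (f := fun g : U2 => (g⁻¹, x)) (by fun_prop)

lemma secondCountable_U2 : SecondCountableTopology U2 := by
  have : SecondCountableTopology (Matrix (Fin 2) (Fin 2) ℂ) :=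
    inferInstanceAs (SecondCountableTopology (Fin 2 → Fin 2 → ℂ))
  exact TopologicalSpace.Subtype.secondCountableTopology _

/-- The orbit average over `U(2)` of a function that is homogeneous of degree two is proportional
to its Lebesgue integral over the unit ball. -/
lemma lintegral_ball_eq {F : C2 → ENNReal} (hF : Measurable F)
    (hhom : ∀ r : ℝ, 0 < r → ∀ x, F (r • x) = ENNReal.ofReal (r ^ 2) * F x) :
    ∫⁻ x in Metric.closedBall (0 : C2) 1, F x =
      (∫⁻ g, F (act g⁻¹ !₂[1, 0]) ∂haarU2) *
        ∫⁻ x in Metric.closedBall (0 : C2) 1, ENNReal.ofReal (‖x‖ ^ 2) := by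
  have := secondCountable_U2
  have hinv (g : U2) : ∫⁻ x in Metric.closedBall (0 : C2) 1, F (act g⁻¹ x) =
      ∫⁻ x in Metric.closedBall (0 : C2) 1, F x := by
    have hpre : act g⁻¹ ⁻¹' Metric.closedBall (0 : C2) 1 = Metric.closedBall (0 : C2) 1 := by
      ext x; simp [norm_act]
    have h := (measurePreserving_act g⁻¹).restrict_preimage
      (Metric.isClosed_closedBall (x := (0 : C2)) (ε := 1)).measurableSet
    rw [hpre] at h
    exact h.lintegral_comp hF
  have hm : Measurable fun z : U2 × C2 => F (act z.1⁻¹ z.2) := by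
    refine hF.comp ?_
    exact (continuous_act.comp (f := fun z : U2 × C2 => (z.1⁻¹, z.2)) (by fun_prop)).measurable
  calc ∫⁻ x in Metric.closedBall (0 : C2) 1, F x
      = ∫⁻ g, (∫⁻ x in Metric.closedBall (0 : C2) 1, F (act g⁻¹ x)) ∂haarU2 := by
        simp [hinv]
    _ = ∫⁻ x in Metric.closedBall (0 : C2) 1, (∫⁻ g, F (act g⁻¹ x) ∂haarU2) :=
        lintegral_lintegral_swap hm.aemeasurable
    _ = ∫⁻ x in Metric.closedBall (0 : C2) 1,
          (∫⁻ g, F (act g⁻¹ !₂[1, 0]) ∂haarU2) * ENNReal.ofReal (‖x‖ ^ 2) := by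
        refine lintegral_congr_ae (ae_restrict_of_ae ?_)
        have h0 : ∀ᵐ x : C2, x ≠ 0 := by simp [ae_iff]
        filter_upwards [h0] with x hx
        have hx' : 0 < ‖x‖ := norm_pos_iff.mpr hx
        obtain ⟨u, hu⟩ := exists_act_eq (n := ‖x‖⁻¹ • x) (by
          rw [norm_smul, norm_inv, norm_norm, inv_mul_cancel₀ hx'.ne'])
        have hxu : x = ‖x‖ • act u !₂[1, 0] := by
          rw [hu, smul_smul, mul_inv_cancel₀ hx'.ne', one_smul]
        rw [← lintegral_act_inv F u !₂[1, 0], mul_comm,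
          ← lintegral_const_mul' _ _ ENNReal.ofReal_ne_top]
        refine lintegral_congr fun g => ?_
        rw [← hhom _ hx', ← map_smul, ← hxu]
    _ = _ := by
        rw [lintegral_const_mul]
        fun_prop

lemma lintegral_ball_norm_sq_ne_zero :
    ∫⁻ x in Metric.closedBall (0 : C2) 1, ENNReal.ofReal (‖x‖ ^ 2) ≠ 0 := by
  rw [Ne, lintegral_eq_zero_iff (by fun_prop)]
  intro h
  have h0 : ∀ᵐ x : C2, x ≠ 0 := by simp [ae_iff]
  have h1 : ∀ᵐ x ∂(volume.restrict (Metric.closedBall (0 : C2) 1)), False := by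
    filter_upwards [h, ae_restrict_of_ae h0] with x hx hx0
    have : 0 < ‖x‖ := norm_pos_iff.mpr hx0
    have h2 : ‖x‖ ^ 2 ≤ 0 := ENNReal.ofReal_eq_zero.mp hx
    nlinarith
  rw [ae_iff] at h1
  simp only [not_false_eq_true] at h1
  rw [show {_x : C2 | True} = Set.univ from Set.eq_univ_of_forall fun _ => trivial,
    Measure.restrict_apply_univ] at h1
  exact (Metric.measure_closedBall_pos volume (0 : C2) one_pos).ne' h1

lemma lintegral_ball_norm_sq_ne_top :
    ∫⁻ x in Metric.closedBall (0 : C2) 1, ENNReal.ofReal (‖x‖ ^ 2) ≠ ⊤ := by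
  refine ne_top_of_le_ne_top (b := ∫⁻ x in Metric.closedBall (0 : C2) 1, 1) ?_ ?_
  · rw [lintegral_one, Measure.restrict_apply_univ]
    exact measure_closedBall_lt_top.ne
  · refine setLIntegral_mono' Metric.isClosed_closedBall.measurableSet fun x hx => ?_
    have h1 : ‖x‖ ≤ 1 := by simpa using hx
    rw [← ENNReal.ofReal_one]
    exact ENNReal.ofReal_le_ofReal (pow_le_one₀ (norm_nonneg x) h1)

/-- Almost no unitary matrix maps a given line into a given proper subspace. -/
lemma ae_act_inv_notMem {S : Submodule ℝ C2} (hS : S ≠ ⊤) :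
    ∀ᵐ g ∂haarU2, act g⁻¹ !₂[1, 0] ∉ S := by
  have hSm : MeasurableSet (S : Set C2) := S.closed_of_finiteDimensional.measurableSet
  -- The function with the value `∞` on `S` is homogeneous of degree two.
  let F : C2 → ENNReal := (S : Set C2).indicator fun _ => ⊤
  have hF : Measurable F := measurable_const.indicator hSm
  have h := lintegral_ball_eq hF fun r hr x => by
    by_cases hx : x ∈ S
    · have hx' : r • x ∈ S := S.smul_mem r hx
      simp only [F, Set.indicator_of_mem (show x ∈ (S : Set C2) from hx),
        Set.indicator_of_mem (show r • x ∈ (S : Set C2) from hx')]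
      rw [ENNReal.mul_top (ENNReal.ofReal_pos.mpr (by positivity)).ne']
    · have hx' : r • x ∉ S := fun h => hx ((S.smul_mem_iff hr.ne').mp h)
      simp only [F, Set.indicator_of_notMem (show x ∉ (S : Set C2) from hx),
        Set.indicator_of_notMem (show r • x ∉ (S : Set C2) from hx'), mul_zero]
  have h0 : ∫⁻ x in Metric.closedBall (0 : C2) 1, F x = 0 := by
    refine nonpos_iff_eq_zero.mp ((setLIntegral_le_lintegral _ _).trans ?_)
    rw [lintegral_indicator_const hSm, Measure.addHaar_submodule volume S hS, mul_zero]
  rw [h0, eq_comm, mul_eq_zero, or_iff_left lintegral_ball_norm_sq_ne_zero,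
    lintegral_eq_zero_iff (show Measurable fun g : U2 => F (act g⁻¹ !₂[1, 0]) from
      hF.comp (continuous_act_inv _).measurable)] at h
  filter_upwards [h] with g hg hmem
  simp only [F, Pi.zero_apply,
    Set.indicator_of_mem (show act g⁻¹ !₂[1, 0] ∈ (S : Set C2) from hmem)] at hg
  exact ENNReal.top_ne_zero hg

end UnitaryAverages

/-! ### The kernel of a plane -/

section Kernel

/-- The contribution `cos²(E^⊥, span (n, m)) / |Pr_{E^⊥} n|²` of the plane `E` orthogonal to the
orthonormal pair `f₀, f₁`. -/
def kernel {V : Type*} [NormedAddCommGroup V] [InnerProductSpace ℝ V] (f₀ f₁ n m : V) : ℝ :=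
  pairing f₀ f₁ n m / (inner ℝ f₀ n ^ 2 + inner ℝ f₁ n ^ 2)

lemma kernel_nonneg {V : Type*} [NormedAddCommGroup V] [InnerProductSpace ℝ V] (f₀ f₁ n m : V) :
    0 ≤ kernel f₀ f₁ n m := div_nonneg (sq_nonneg _) (by positivity)

lemma kernel_act (g : U2) (f₀ f₁ n m : C2) :
    kernel (act g f₀) (act g f₁) n m = kernel f₀ f₁ (act g⁻¹ n) (act g⁻¹ m) := by
  simp only [kernel, pairing, inner_real_act_left]

lemma div_sq_add_sq_le (a b c d : ℝ) :
    (a * d - c * b) ^ 2 / (a ^ 2 + b ^ 2) ≤ c ^ 2 + d ^ 2 := by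
  refine div_le_of_le_mul₀ (by positivity) (by positivity) ?_
  nlinarith [sq_nonneg (a * c + b * d)]

lemma kernel_le {V : Type*} [NormedAddCommGroup V] [InnerProductSpace ℝ V] (f₀ f₁ n m : V) :
    kernel f₀ f₁ n m ≤ (‖f₀‖ * ‖m‖) ^ 2 + (‖f₁‖ * ‖m‖) ^ 2 := by
  refine (div_sq_add_sq_le _ _ _ _).trans ?_
  refine add_le_add ?_ ?_ <;> rw [← sq_abs] <;> gcongr <;> exact abs_real_inner_le_norm _ _

lemma integrable_haarU2_of_bound {F : U2 → ℝ} (hF : Measurable F) (C : ℝ)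
    (h0 : ∀ g, 0 ≤ F g) (h : ∀ g, F g ≤ C) : Integrable F haarU2 :=
  Integrable.of_bound hF.aestronglyMeasurable C
    (Filter.Eventually.of_forall fun g => by rw [Real.norm_of_nonneg (h0 g)]; exact h g)

lemma measurable_kernel_act_inv (f₀ f₁ n m : C2) :
    Measurable fun g : U2 => kernel f₀ f₁ (act g⁻¹ n) (act g⁻¹ m) := by
  have h (f x : C2) : Measurable fun g : U2 => inner ℝ f (act g⁻¹ x) :=
    (continuous_const.inner (continuous_act_inv x)).measurable
  exact ((((h f₀ n).mul (h f₁ m)).sub ((h f₀ m).mul (h f₁ n))).pow_const 2).div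
    (((h f₀ n).pow_const 2).add ((h f₁ n).pow_const 2))

lemma integrable_kernel_act_inv (f₀ f₁ n m : C2) :
    Integrable (fun g : U2 => kernel f₀ f₁ (act g⁻¹ n) (act g⁻¹ m)) haarU2 :=
  integrable_haarU2_of_bound (measurable_kernel_act_inv f₀ f₁ n m)
    ((‖f₀‖ * ‖m‖) ^ 2 + (‖f₁‖ * ‖m‖) ^ 2) (fun g => kernel_nonneg _ _ _ _)
    fun g => (kernel_le _ _ _ _).trans_eq (by rw [norm_act])

lemma integral_act_inv₂ (F : C2 → C2 → ℝ) (u : U2) (x y : C2) :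
    ∫ g, F (act g⁻¹ (act u x)) (act g⁻¹ (act u y)) ∂haarU2 =
      ∫ g, F (act g⁻¹ x) (act g⁻¹ y) ∂haarU2 := by
  rw [← integral_mul_left_eq_self (μ := haarU2) (fun g => F (act g⁻¹ x) (act g⁻¹ y)) u⁻¹]
  simp [act_mul]

/-- Averaging over the fourth roots of unity acting on the second coordinate, which removes the
mixed terms in `z` and `w`. -/
lemma four_mul_integral_kernel (f₀ f₁ : C2) (z w : ℂ) :
    4 * ∫ g, kernel f₀ f₁ (act g⁻¹ !₂[1, 0]) (act g⁻¹ !₂[z, w]) ∂haarU2 =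
      ∫ g, (kernel f₀ f₁ (act g⁻¹ !₂[1, 0]) (act g⁻¹ !₂[z, w]) +
        kernel f₀ f₁ (act g⁻¹ !₂[1, 0]) (act g⁻¹ !₂[z, -w]) +
        (kernel f₀ f₁ (act g⁻¹ !₂[1, 0]) (act g⁻¹ !₂[z, Complex.I * w]) +
        kernel f₀ f₁ (act g⁻¹ !₂[1, 0]) (act g⁻¹ !₂[z, -(Complex.I * w)]))) ∂haarU2 := by
  have h (ζ : ℂ) (hζ : ‖ζ‖ = 1) :
      ∫ g, kernel f₀ f₁ (act g⁻¹ !₂[1, 0]) (act g⁻¹ !₂[z, ζ * w]) ∂haarU2 =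
      ∫ g, kernel f₀ f₁ (act g⁻¹ !₂[1, 0]) (act g⁻¹ !₂[z, w]) ∂haarU2 := by
    rw [← integral_act_inv₂ (kernel f₀ f₁) (diagUnitary ζ hζ) !₂[1, 0] !₂[z, w]]
    simp only [act_diagUnitary, mul_zero]
  have h1 := h (-1) (by simp)
  have h2 := h Complex.I (by simp)
  have h3 := h (-Complex.I) (by simp)
  simp only [neg_mul, one_mul] at h1 h3
  have hi (y : ℂ) := integrable_kernel_act_inv f₀ f₁ !₂[1, 0] !₂[z, y]
  have hadd {k₁ k₂ k₃ k₄ : U2 → ℝ} (i₁ : Integrable k₁ haarU2) (i₂ : Integrable k₂ haarU2)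
      (i₃ : Integrable k₃ haarU2) (i₄ : Integrable k₄ haarU2) :
      ∫ g, (k₁ g + k₂ g + (k₃ g + k₄ g)) ∂haarU2 = ∫ g, k₁ g ∂haarU2 + ∫ g, k₂ g ∂haarU2 +
        (∫ g, k₃ g ∂haarU2 + ∫ g, k₄ g ∂haarU2) := by
    rw [integral_add (f := fun g => k₁ g + k₂ g) (g := fun g => k₃ g + k₄ g) (i₁.add i₂)
      (i₃.add i₄), integral_add i₁ i₂, integral_add i₃ i₄]
  rw [hadd (hi _) (hi _) (hi _) (hi _), h1, h2, h3]
  ring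

section Entries

variable (h : U2)

lemma normSq_col (j : Fin 2) : Complex.normSq (h.1 0 j) + Complex.normSq (h.1 1 j) = 1 := by
  have h1 := congrFun (congrFun (Matrix.mem_unitaryGroup_iff'.mp h.2) j) j
  rw [Matrix.mul_apply, Fin.sum_univ_two] at h1
  simp only [Matrix.star_apply, RCLike.star_def, Matrix.one_apply_eq,
    Complex.normSq_eq_conj_mul_self.symm] at h1
  exact_mod_cast h1

lemma normSq_row (i : Fin 2) : Complex.normSq (h.1 i 0) + Complex.normSq (h.1 i 1) = 1 := by
  have h1 := congrFun (congrFun (Matrix.mem_unitaryGroup_iff.mp h.2) i) i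
  rw [Matrix.mul_apply, Fin.sum_univ_two] at h1
  simp only [Matrix.star_apply, RCLike.star_def, Matrix.one_apply_eq, Complex.mul_conj] at h1
  exact_mod_cast h1

/-- The second column of a unitary matrix is a phase times the rotated conjugate of the first. -/
lemma exists_phase : ∃ δ : ℂ, Complex.normSq δ = 1 ∧
    h.1 0 1 = -δ * (starRingEnd ℂ) (h.1 1 0) ∧ h.1 1 1 = δ * (starRingEnd ℂ) (h.1 0 0) := by
  have hc := congrFun (congrFun (Matrix.mem_unitaryGroup_iff'.mp h.2) 0) 1
  rw [Matrix.mul_apply, Fin.sum_univ_two] at hc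
  simp only [Matrix.star_apply, RCLike.star_def, ne_eq, zero_ne_one, not_false_eq_true,
    Matrix.one_apply_ne] at hc
  have h0 : h.1 0 0 * (starRingEnd ℂ) (h.1 0 0) + h.1 1 0 * (starRingEnd ℂ) (h.1 1 0) = 1 := by
    rw [Complex.mul_conj, Complex.mul_conj]; exact_mod_cast normSq_col h 0
  obtain ⟨δ, hδ⟩ : ∃ δ, δ = h.1 0 0 * h.1 1 1 - h.1 0 1 * h.1 1 0 := ⟨_, rfl⟩
  have e1 : h.1 0 1 = -δ * (starRingEnd ℂ) (h.1 1 0) := by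
    rw [hδ]; linear_combination -h.1 0 1 * h0 + h.1 0 0 * hc
  have e2 : h.1 1 1 = δ * (starRingEnd ℂ) (h.1 0 0) := by
    rw [hδ]; linear_combination -h.1 1 1 * h0 + h.1 1 0 * hc
  refine ⟨δ, ?_, e1, e2⟩
  have e3 := normSq_col h 1
  rw [e1, e2, map_mul, map_mul, Complex.normSq_neg, Complex.normSq_conj, Complex.normSq_conj,
    ← mul_add, add_comm, normSq_col h 0, mul_one] at e3
  exact e3

end Entries

end Kernel

/-! ### Moments of the orbit measure on the sphere -/

section Moments

/-- The quotient `det(X, Y)² / |Y|²` for a vector `X + iY` of `ℂ²`. -/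
def crossRatio (x : C2) : ℝ :=
  ((x 0).re * (x 1).im - (x 1).re * (x 0).im) ^ 2 / ((x 0).im ^ 2 + (x 1).im ^ 2)

/-- The quotient `⟨X, Y⟩² / |Y|²` for a vector `X + iY` of `ℂ²`. -/
def dotRatio (x : C2) : ℝ :=
  ((x 0).re * (x 0).im + (x 1).re * (x 1).im) ^ 2 / ((x 0).im ^ 2 + (x 1).im ^ 2)

lemma normSq_add_normSq (x : C2) : Complex.normSq (x 0) + Complex.normSq (x 1) = ‖x‖ ^ 2 := by
  rw [EuclideanSpace.norm_sq_eq, Fin.sum_univ_two, Complex.normSq_eq_norm_sq,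
    Complex.normSq_eq_norm_sq]

lemma crossRatio_nonneg (x : C2) : 0 ≤ crossRatio x := div_nonneg (sq_nonneg _) (by positivity)

lemma dotRatio_nonneg (x : C2) : 0 ≤ dotRatio x := div_nonneg (sq_nonneg _) (by positivity)

lemma crossRatio_le (x : C2) : crossRatio x ≤ ‖x‖ ^ 2 := by
  rw [← normSq_add_normSq, Complex.normSq_apply, Complex.normSq_apply]
  refine div_le_of_le_mul₀ (by positivity) (add_nonneg
    (add_nonneg (mul_self_nonneg _) (mul_self_nonneg _))
    (add_nonneg (mul_self_nonneg _) (mul_self_nonneg _))) ?_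
  nlinarith [sq_nonneg ((x 0).re * (x 0).im + (x 1).re * (x 1).im),
    sq_nonneg ((x 0).im ^ 2 + (x 1).im ^ 2)]

lemma dotRatio_le (x : C2) : dotRatio x ≤ ‖x‖ ^ 2 := by
  rw [← normSq_add_normSq, Complex.normSq_apply, Complex.normSq_apply]
  refine div_le_of_le_mul₀ (by positivity) (add_nonneg
    (add_nonneg (mul_self_nonneg _) (mul_self_nonneg _))
    (add_nonneg (mul_self_nonneg _) (mul_self_nonneg _))) ?_
  nlinarith [sq_nonneg ((x 0).re * (x 1).im - (x 1).re * (x 0).im),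
    sq_nonneg ((x 0).im ^ 2 + (x 1).im ^ 2)]

lemma measurable_crossRatio : Measurable crossRatio := by
  have h (i : Fin 2) : Continuous fun x : C2 => x i := by fun_prop
  have hr (i : Fin 2) : Measurable fun x : C2 => (x i).re :=
    (Complex.continuous_re.comp (h i)).measurable
  have hi (i : Fin 2) : Measurable fun x : C2 => (x i).im :=
    (Complex.continuous_im.comp (h i)).measurable
  exact ((((hr 0).mul (hi 1)).sub ((hr 1).mul (hi 0))).pow_const 2).div
    (((hi 0).pow_const 2).add ((hi 1).pow_const 2))

lemma measurable_dotRatio : Measurable dotRatio := by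
  have h (i : Fin 2) : Continuous fun x : C2 => x i := by fun_prop
  have hr (i : Fin 2) : Measurable fun x : C2 => (x i).re :=
    (Complex.continuous_re.comp (h i)).measurable
  have hi (i : Fin 2) : Measurable fun x : C2 => (x i).im :=
    (Complex.continuous_im.comp (h i)).measurable
  exact ((((hr 0).mul (hi 0)).add ((hr 1).mul (hi 1))).pow_const 2).div
    (((hi 0).pow_const 2).add ((hi 1).pow_const 2))

lemma crossRatio_smul (r : ℝ) (x : C2) : crossRatio (r • x) = r ^ 2 * crossRatio x := by
  rcases eq_or_ne r 0 with rfl | hr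
  · simp [crossRatio]
  by_cases h : (x 0).im ^ 2 + (x 1).im ^ 2 = 0
  · have h' : (r * (x 0).im) ^ 2 + (r * (x 1).im) ^ 2 = 0 := by linear_combination r ^ 2 * h
    simp [crossRatio, h, h']
  · have h' : (r * (x 0).im) ^ 2 + (r * (x 1).im) ^ 2 ≠ 0 := by
      rw [mul_pow, mul_pow, ← mul_add]; positivity
    simp only [crossRatio, PiLp.smul_apply, Complex.real_smul, Complex.re_ofReal_mul,
      Complex.im_ofReal_mul]
    field_simp

lemma dotRatio_smul (r : ℝ) (x : C2) : dotRatio (r • x) = r ^ 2 * dotRatio x := by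
  rcases eq_or_ne r 0 with rfl | hr
  · simp [dotRatio]
  by_cases h : (x 0).im ^ 2 + (x 1).im ^ 2 = 0
  · have h' : (r * (x 0).im) ^ 2 + (r * (x 1).im) ^ 2 = 0 := by linear_combination r ^ 2 * h
    simp [dotRatio, h, h']
  · have h' : (r * (x 0).im) ^ 2 + (r * (x 1).im) ^ 2 ≠ 0 := by
      rw [mul_pow, mul_pow, ← mul_add]; positivity
    simp only [dotRatio, PiLp.smul_apply, Complex.real_smul, Complex.re_ofReal_mul,
      Complex.im_ofReal_mul]
    field_simp

/-- The quarter turn of the real parts, with the imaginary parts fixed: an element of `O(4)` which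
is not in `U(2)`. -/
def turnRe : C2 →ₗᵢ[ℝ] C2 where
  toFun x := !₂[⟨-(x 1).re, (x 0).im⟩, ⟨(x 0).re, (x 1).im⟩]
  map_add' x y := by
    ext i; fin_cases i <;> apply Complex.ext <;> simp; ring
  map_smul' r x := by
    ext i; fin_cases i <;> apply Complex.ext <;> simp
  norm_map' x := by
    refine (sq_eq_sq₀ (norm_nonneg _) (norm_nonneg _)).mp ?_
    rw [← normSq_add_normSq, ← normSq_add_normSq]
    simp [Complex.normSq_apply]
    ring

lemma dotRatio_turnRe (x : C2) : dotRatio (turnRe x) = crossRatio x := by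
  simp only [dotRatio, crossRatio, turnRe, LinearIsometry.coe_mk, LinearMap.coe_mk,
    AddHom.coe_mk, PiLp.toLp_apply, Matrix.cons_val_zero, Matrix.cons_val_one]
  congr 1
  ring

/-- The orbit measure on the sphere is compared with Lebesgue measure on the ball, which is
invariant under all of `O(4)`, in particular under `turnRe`. -/
lemma integral_crossRatio_eq :
    ∫ g, crossRatio (act g⁻¹ !₂[1, 0]) ∂haarU2 = ∫ g, dotRatio (act g⁻¹ !₂[1, 0]) ∂haarU2 := by
  have h1 := lintegral_ball_eq (F := fun x => ENNReal.ofReal (crossRatio x))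
    measurable_crossRatio.ennreal_ofReal fun r hr x => by
      rw [crossRatio_smul, ENNReal.ofReal_mul (by positivity)]
  have h2 := lintegral_ball_eq (F := fun x => ENNReal.ofReal (dotRatio x))
    measurable_dotRatio.ennreal_ofReal fun r hr x => by
      rw [dotRatio_smul, ENNReal.ofReal_mul (by positivity)]
  have h3 : ∫⁻ x in Metric.closedBall (0 : C2) 1, ENNReal.ofReal (crossRatio x) =
      ∫⁻ x in Metric.closedBall (0 : C2) 1, ENNReal.ofReal (dotRatio x) := by
    have hmp : MeasurePreserving turnRe := (turnRe.toLinearIsometryEquiv rfl).measurePreserving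
    have hpre : turnRe ⁻¹' Metric.closedBall (0 : C2) 1 = Metric.closedBall (0 : C2) 1 := by
      ext x; simp
    have h := hmp.restrict_preimage
      (Metric.isClosed_closedBall (x := (0 : C2)) (ε := 1)).measurableSet
    rw [hpre] at h
    rw [← h.lintegral_comp measurable_dotRatio.ennreal_ofReal]
    simp only [dotRatio_turnRe]
  rw [h1, h2, ENNReal.mul_left_inj lintegral_ball_norm_sq_ne_zero
    lintegral_ball_norm_sq_ne_top] at h3
  rw [integral_eq_lintegral_of_nonneg_ae (Filter.Eventually.of_forall fun g => crossRatio_nonneg _)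
    (measurable_crossRatio.comp (continuous_act_inv _).measurable).aestronglyMeasurable,
    integral_eq_lintegral_of_nonneg_ae (Filter.Eventually.of_forall fun g => dotRatio_nonneg _)
    (measurable_dotRatio.comp (continuous_act_inv _).measurable).aestronglyMeasurable, h3]

lemma norm_base : ‖(!₂[1, 0] : C2)‖ = 1 := by
  simp [EuclideanSpace.norm_eq]

lemma integral_act_inv_eq_of_norm (F : C2 → ℝ) {x : C2} (hx : ‖x‖ = 1) :
    ∫ g, F (act g⁻¹ x) ∂haarU2 = ∫ g, F (act g⁻¹ !₂[1, 0]) ∂haarU2 := by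
  obtain ⟨u, hu⟩ := exists_act_eq hx
  rw [← hu]
  exact integral_act_inv₂ (fun a _ => F a) u !₂[1, 0] 0

lemma integrable_act_inv_of_le {F : C2 → ℝ} (hF : Measurable F) (h0 : ∀ x, 0 ≤ F x)
    (h1 : ∀ x, F x ≤ ‖x‖ ^ 2) (x : C2) : Integrable (fun g => F (act g⁻¹ x)) haarU2 :=
  integrable_haarU2_of_bound (hF.comp (continuous_act_inv x).measurable) (‖x‖ ^ 2)
    (fun _ => h0 _) fun _ => (h1 _).trans_eq (by rw [norm_act])

lemma normSq_apply_le (i : Fin 2) (x : C2) : Complex.normSq (x i) ≤ ‖x‖ ^ 2 := by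
  rw [← normSq_add_normSq]
  fin_cases i
  · exact le_add_of_nonneg_right (Complex.normSq_nonneg _)
  · exact le_add_of_nonneg_left (Complex.normSq_nonneg _)

lemma integrable_normSq_apply (i : Fin 2) (x : C2) :
    Integrable (fun g => Complex.normSq ((act g⁻¹ x) i)) haarU2 :=
  integrable_act_inv_of_le (F := fun x => Complex.normSq (x i))
    (Complex.continuous_normSq.comp (by fun_prop)).measurable (fun _ => Complex.normSq_nonneg _)
    (normSq_apply_le i) x

lemma integral_normSq_apply {x : C2} (hx : ‖x‖ = 1) :
    ∫ g, Complex.normSq ((act g⁻¹ x) 1) ∂haarU2 = 1 / 2 := by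
  rw [integral_act_inv_eq_of_norm (fun x => Complex.normSq (x 1)) hx]
  have h1 : ∫ g, Complex.normSq ((act g⁻¹ !₂[0, 1]) 1) ∂haarU2 =
      ∫ g, Complex.normSq ((act g⁻¹ !₂[1, 0]) 1) ∂haarU2 :=
    integral_act_inv_eq_of_norm (fun x => Complex.normSq (x 1)) (by simp [EuclideanSpace.norm_eq])
  have h2 : ∫ g, (Complex.normSq ((act g⁻¹ !₂[1, 0]) 1) +
      Complex.normSq ((act g⁻¹ !₂[0, 1]) 1)) ∂haarU2 = 1 := by
    have (g : U2) : Complex.normSq ((act g⁻¹ !₂[1, 0]) 1) +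
        Complex.normSq ((act g⁻¹ !₂[0, 1]) 1) = 1 := by
      simp only [act_mk]
      simpa using normSq_row g⁻¹ 1
    simp [this]
  rw [integral_add (integrable_normSq_apply _ _) (integrable_normSq_apply _ _), h1] at h2
  linarith

/-- The squared length of the imaginary part. -/
def imNormSq (x : C2) : ℝ := (x 0).im ^ 2 + (x 1).im ^ 2

lemma integrable_imNormSq (x : C2) : Integrable (fun g => imNormSq (act g⁻¹ x)) haarU2 := by
  refine integrable_act_inv_of_le (F := imNormSq) (Continuous.measurable ?_)
    (fun x => by unfold imNormSq; positivity) (fun x => ?_) x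
  · have h (i : Fin 2) : Continuous fun x : C2 => (x i).im :=
      Complex.continuous_im.comp (by fun_prop)
    exact ((h 0).pow 2).add ((h 1).pow 2)
  · rw [← normSq_add_normSq, Complex.normSq_apply, Complex.normSq_apply, imNormSq]
    nlinarith [sq_nonneg (x 0).re, sq_nonneg (x 1).re]

lemma integral_imNormSq : ∫ g, imNormSq (act g⁻¹ !₂[1, 0]) ∂haarU2 = 1 / 2 := by
  have h1 : ∫ g, imNormSq (act g⁻¹ (Complex.I • !₂[1, 0])) ∂haarU2 =
      ∫ g, imNormSq (act g⁻¹ !₂[1, 0]) ∂haarU2 :=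
    integral_act_inv_eq_of_norm imNormSq (by rw [norm_smul, norm_base]; simp)
  have h2 : ∫ g, (imNormSq (act g⁻¹ !₂[1, 0]) +
      imNormSq (act g⁻¹ (Complex.I • !₂[1, 0]))) ∂haarU2 = 1 := by
    have (g : U2) : imNormSq (act g⁻¹ !₂[1, 0]) +
        imNormSq (act g⁻¹ (Complex.I • !₂[1, 0])) = 1 := by
      have h3 := normSq_add_normSq (act g⁻¹ !₂[1, 0])
      rw [norm_act, norm_base, Complex.normSq_apply, Complex.normSq_apply] at h3
      rw [act_smul]
      simp only [imNormSq, PiLp.smul_apply, smul_eq_mul, Complex.I_mul_im]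
      linarith
    simp [this]
  rw [integral_add (integrable_imNormSq _) (integrable_imNormSq _), h1] at h2
  linarith

lemma ae_snd_ne_zero : ∀ᵐ g ∂haarU2, (act g⁻¹ !₂[1, 0]) 1 ≠ 0 := by
  let S : Submodule ℝ C2 :=
    { carrier := {x | x 1 = 0}
      add_mem' := fun {x y} hx hy => by
        simp only [Set.mem_ofPred_eq, PiLp.add_apply] at hx hy ⊢; rw [hx, hy, add_zero]
      zero_mem' := by simp
      smul_mem' := fun r x hx => by
        simp only [Set.mem_ofPred_eq, PiLp.smul_apply] at hx ⊢; rw [hx, smul_zero] }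
  refine ae_act_inv_notMem (S := S) fun h => ?_
  have hmem : (!₂[0, 1] : C2) ∈ S := h ▸ Submodule.mem_top
  have : (!₂[0, 1] : C2) 1 = 0 := hmem
  simp at this

lemma ae_imNormSq_ne_zero : ∀ᵐ g ∂haarU2, imNormSq (act g⁻¹ !₂[1, 0]) ≠ 0 := by
  let S : Submodule ℝ C2 :=
    { carrier := {x | (x 0).im = 0 ∧ (x 1).im = 0}
      add_mem' := fun {x y} hx hy => by
        simp only [Set.mem_ofPred_eq, PiLp.add_apply, Complex.add_im] at hx hy ⊢
        simp [hx, hy]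
      zero_mem' := by simp
      smul_mem' := fun r x hx => by
        simp only [Set.mem_ofPred_eq, PiLp.smul_apply] at hx ⊢
        simp [hx] }
  have hS : S ≠ ⊤ := fun h => by
    have : (!₂[0, Complex.I] : C2) ∈ S := h ▸ Submodule.mem_top
    exact one_ne_zero (α := ℝ) (by simpa [S] using this.2)
  filter_upwards [ae_act_inv_notMem hS] with g hg h0
  refine hg ⟨?_, ?_⟩ <;> unfold imNormSq at h0 <;>
    nlinarith [sq_nonneg ((act g⁻¹ !₂[1, 0]) 0).im, sq_nonneg ((act g⁻¹ !₂[1, 0]) 1).im]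

lemma integrable_crossRatio (x : C2) : Integrable (fun g => crossRatio (act g⁻¹ x)) haarU2 :=
  integrable_act_inv_of_le measurable_crossRatio crossRatio_nonneg crossRatio_le x

lemma integrable_dotRatio (x : C2) : Integrable (fun g => dotRatio (act g⁻¹ x)) haarU2 :=
  integrable_act_inv_of_le measurable_dotRatio dotRatio_nonneg dotRatio_le x

/-- The two quotients have the same average and add up to `|X|² = 1 - |Y|²`, whose average is
`1 / 2`. -/
lemma integral_crossRatio : ∫ g, crossRatio (act g⁻¹ !₂[1, 0]) ∂haarU2 = 1 / 4 := by
  have h1 : ∫ g, (crossRatio (act g⁻¹ !₂[1, 0]) + dotRatio (act g⁻¹ !₂[1, 0]) +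
      imNormSq (act g⁻¹ !₂[1, 0])) ∂haarU2 = 1 := by
    have : (fun g => crossRatio (act g⁻¹ !₂[1, 0]) + dotRatio (act g⁻¹ !₂[1, 0]) +
        imNormSq (act g⁻¹ !₂[1, 0])) =ᵐ[haarU2] fun _ => 1 := by
      filter_upwards [ae_imNormSq_ne_zero] with g hg
      have h3 := normSq_add_normSq (act g⁻¹ !₂[1, 0])
      rw [norm_act, norm_base, Complex.normSq_apply, Complex.normSq_apply] at h3
      unfold imNormSq at hg
      unfold crossRatio dotRatio imNormSq
      field_simp
      linear_combination (((act g⁻¹ !₂[1, 0]) 0).im ^ 2 + ((act g⁻¹ !₂[1, 0]) 1).im ^ 2) * h3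
    rw [integral_congr_ae this]
    simp
  rw [integral_add (f := fun g => crossRatio (act g⁻¹ !₂[1, 0]) + dotRatio (act g⁻¹ !₂[1, 0]))
    ((integrable_crossRatio _).add (integrable_dotRatio _)) (integrable_imNormSq _),
    integral_add (integrable_crossRatio _) (integrable_dotRatio _), ← integral_crossRatio_eq,
    integral_imNormSq] at h1
  linarith

end Moments

/-! ### Averages of the kernel -/

section KernelAverages

/-- The average of the kernel over the complex lines. Only vectors orthogonal to `!₂[1, 0]` matter,
whose first coordinate is imaginary. The orthogonal complement of `ComplexLine.base` is spanned by
`!₂[0, 1]` and `!₂[0, I]`. -/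
lemma integral_kernel_complex (c : ℝ) (w : ℂ) :
    ∫ g, kernel !₂[0, 1] !₂[0, Complex.I] (act g⁻¹ !₂[1, 0]) (act g⁻¹ !₂[⟨0, c⟩, w]) ∂haarU2 =
      c ^ 2 / 2 + Complex.normSq w / 4 := by
  have h4 := four_mul_integral_kernel !₂[0, 1] !₂[0, Complex.I] ⟨0, c⟩ w
  have hae : (fun g : U2 => kernel !₂[0, 1] !₂[0, Complex.I] (act g⁻¹ !₂[1, 0])
        (act g⁻¹ !₂[⟨0, c⟩, w]) +
      kernel !₂[0, 1] !₂[0, Complex.I] (act g⁻¹ !₂[1, 0]) (act g⁻¹ !₂[⟨0, c⟩, -w]) +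
      (kernel !₂[0, 1] !₂[0, Complex.I] (act g⁻¹ !₂[1, 0]) (act g⁻¹ !₂[⟨0, c⟩, Complex.I * w]) +
      kernel !₂[0, 1] !₂[0, Complex.I] (act g⁻¹ !₂[1, 0])
        (act g⁻¹ !₂[⟨0, c⟩, -(Complex.I * w)]))) =ᵐ[haarU2]
      fun g => 4 * c ^ 2 * Complex.normSq ((act g⁻¹ !₂[1, 0]) 1) +
        2 * Complex.normSq w * Complex.normSq ((act g⁻¹ !₂[0, 1]) 1) := by
    filter_upwards [ae_snd_ne_zero] with g hg
    simp only [act_mk] at hg ⊢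
    simp only [kernel, pairing, PiLp.inner_apply, Fin.sum_univ_two, Complex.inner,
      Matrix.cons_val_zero, Matrix.cons_val_one] at hg ⊢
    generalize (g⁻¹).1 1 0 = a at hg ⊢
    generalize (g⁻¹).1 1 1 = d
    have ha : a.re ^ 2 + a.im ^ 2 ≠ 0 := by
      intro h
      apply hg
      have h1 : a = 0 := by
        apply Complex.normSq_eq_zero.mp
        rw [Complex.normSq_apply]; linarith
      simp [h1]
    simp [Complex.normSq_apply]
    field_simp
    ring
  rw [integral_congr_ae hae, integral_add ((integrable_normSq_apply _ _).const_mul _)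
    ((integrable_normSq_apply _ _).const_mul _), integral_const_mul, integral_const_mul,
    integral_normSq_apply norm_base, integral_normSq_apply (by simp [EuclideanSpace.norm_eq])] at h4
  linarith

/-- The average of the kernel over the Lagrangian planes. The orthogonal complement of
`LagrangianPlane.base` is spanned by `!₂[I, 0]` and `!₂[0, I]`. -/
lemma integral_kernel_lagrangian (c : ℝ) (w : ℂ) :
    ∫ g, kernel !₂[Complex.I, 0] !₂[0, Complex.I] (act g⁻¹ !₂[1, 0])
      (act g⁻¹ !₂[⟨0, c⟩, w]) ∂haarU2 = c ^ 2 / 4 + 3 * Complex.normSq w / 8 := by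
  have h4 := four_mul_integral_kernel !₂[Complex.I, 0] !₂[0, Complex.I] ⟨0, c⟩ w
  have hae : (fun g : U2 => kernel !₂[Complex.I, 0] !₂[0, Complex.I] (act g⁻¹ !₂[1, 0])
        (act g⁻¹ !₂[⟨0, c⟩, w]) +
      kernel !₂[Complex.I, 0] !₂[0, Complex.I] (act g⁻¹ !₂[1, 0]) (act g⁻¹ !₂[⟨0, c⟩, -w]) +
      (kernel !₂[Complex.I, 0] !₂[0, Complex.I] (act g⁻¹ !₂[1, 0])
        (act g⁻¹ !₂[⟨0, c⟩, Complex.I * w]) +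
      kernel !₂[Complex.I, 0] !₂[0, Complex.I] (act g⁻¹ !₂[1, 0])
        (act g⁻¹ !₂[⟨0, c⟩, -(Complex.I * w)]))) =ᵐ[haarU2]
      fun g => 4 * c ^ 2 * crossRatio (act g⁻¹ !₂[1, 0]) +
        (2 * Complex.normSq w * dotRatio (act g⁻¹ !₂[1, 0]) +
          2 * Complex.normSq w * imNormSq (act g⁻¹ !₂[1, 0])) := by
    filter_upwards [ae_imNormSq_ne_zero] with g hg
    obtain ⟨δ, hδ, h01, h11⟩ := exists_phase g⁻¹
    simp only [act_mk, h01, h11] at hg ⊢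
    simp only [kernel, pairing, crossRatio, dotRatio, imNormSq, PiLp.inner_apply,
      Fin.sum_univ_two, Complex.inner, Matrix.cons_val_zero,
      Matrix.cons_val_one] at hg ⊢
    generalize (g⁻¹).1 0 0 = a at hg ⊢
    generalize (g⁻¹).1 1 0 = d at hg ⊢
    have ha : a.im ^ 2 + d.im ^ 2 ≠ 0 := by simpa using hg
    rw [Complex.normSq_apply] at hδ ⊢
    simp
    field_simp
    linear_combination 2 * (w.re * w.re + w.im * w.im) * ((a.re * a.im + d.re * d.im) ^ 2 +
      (a.im ^ 2 + d.im ^ 2) ^ 2) * hδ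
  have hi₁ := (integrable_dotRatio !₂[1, 0]).const_mul (2 * Complex.normSq w)
  have hi₂ := (integrable_imNormSq !₂[1, 0]).const_mul (2 * Complex.normSq w)
  rw [integral_congr_ae hae, integral_add (g := fun g =>
      2 * Complex.normSq w * dotRatio (act g⁻¹ !₂[1, 0]) +
        2 * Complex.normSq w * imNormSq (act g⁻¹ !₂[1, 0]))
    ((integrable_crossRatio _).const_mul _) (hi₁.add hi₂), integral_add hi₁ hi₂,
    integral_const_mul, integral_const_mul,
    integral_const_mul, ← integral_crossRatio_eq, integral_crossRatio, integral_imNormSq] at h4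
  linarith

/-- The combination of the two averages is the same for all orthonormal pairs `n, m`: this is the
numerical identity behind the theorem,
`(c² / 2 + |w|² / 4) + 2 (c² / 4 + 3 |w|² / 8) = c² + |w|²`. -/
lemma lintegral_kernel_add {n m : C2} (hn : ‖n‖ = 1) (hm : ‖m‖ = 1) (hnm : inner ℝ n m = 0) :
    ∫⁻ g, ENNReal.ofReal (kernel (act g !₂[0, 1]) (act g !₂[0, Complex.I]) n m) ∂haarU2 +
      2 * ∫⁻ g, ENNReal.ofReal (kernel (act g !₂[Complex.I, 0]) (act g !₂[0, Complex.I]) n m)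
        ∂haarU2 = 1 := by
  obtain ⟨u, rfl⟩ := exists_act_eq hn
  obtain ⟨m, rfl⟩ : ∃ m', act u m' = m := ⟨act u⁻¹ m, by rw [← act_mul, mul_inv_cancel, act_one]⟩
  rw [norm_act] at hm
  rw [inner_real_act] at hnm
  have hre : (m 0).re = 0 := by
    simpa [PiLp.inner_apply, Complex.inner] using hnm
  obtain ⟨c, w, rfl⟩ : ∃ (c : ℝ) (w : ℂ), m = !₂[⟨0, c⟩, w] := by
    refine ⟨(m 0).im, m 1, ?_⟩
    ext i
    fin_cases i
    · exact Complex.ext hre rfl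
    · rfl
  have hone : c ^ 2 + Complex.normSq w = 1 := by
    have h := normSq_add_normSq !₂[⟨0, c⟩, w]
    rw [hm, Complex.normSq_apply] at h
    simp only [Matrix.cons_val_zero, Matrix.cons_val_one] at h
    linarith
  have hconv (f₀ f₁ : C2) : ∫⁻ g, ENNReal.ofReal (kernel (act g f₀) (act g f₁)
      (act u !₂[1, 0]) (act u !₂[⟨0, c⟩, w])) ∂haarU2 =
      ENNReal.ofReal (∫ g, kernel f₀ f₁ (act g⁻¹ !₂[1, 0])
        (act g⁻¹ !₂[⟨0, c⟩, w]) ∂haarU2) := by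
    simp only [kernel_act]
    rw [← ofReal_integral_eq_lintegral_ofReal (integrable_kernel_act_inv _ _ _ _)
      (Filter.Eventually.of_forall fun g => kernel_nonneg _ _ _ _),
      integral_act_inv₂ (kernel f₀ f₁)]
  rw [hconv, hconv, integral_kernel_complex, integral_kernel_lagrangian]
  have h0 := Complex.normSq_nonneg w
  have two : (2 : ENNReal) = ENNReal.ofReal 2 := by simp
  rw [two, ← ENNReal.ofReal_mul zero_le_two,
    ← ENNReal.ofReal_add (by positivity) (by positivity), ENNReal.ofReal_eq_one]
  linarith

end KernelAverages

/-! ### Integration over the planes -/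

section PlaneIntegral

/-- The integral over the shell around `K` that computes the area of the projection of `K` to the
plane with orthogonal projection `P`. -/
def planeIntegral (K : Set C2) (p : C2 → C2) (P : C2 →L[ℝ] C2) : ENNReal :=
  ∫⁻ x in Kᶜ ∩ {x | ‖x - p x‖ ≤ 1}, ENNReal.ofReal (projJacobian p P x *
    (‖x - p x‖ ^ 2 / ‖(x - p x) - P (x - p x)‖ ^ 2))

lemma finrank_C2 : Module.finrank ℝ C2 = 4 := by
  rw [← Module.finrank_mul_finrank ℝ ℂ C2]
  simp

lemma IsPlaneProjection.map_act {B : Submodule ℝ C2} {f₀ f₁ : C2}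
    (h : IsPlaneProjection B.starProjection f₀ f₁) (g : U2) :
    IsPlaneProjection (B.map (act g)).starProjection (act g f₀) (act g f₁) where
  norm₀ := by rw [norm_act, h.norm₀]
  norm₁ := by rw [norm_act, h.norm₁]
  inner_eq := by rw [inner_real_act, h.inner_eq]
  apply_eq x := by
    rw [starProjection_map_act, h.apply_eq, map_sub, map_sub, map_smul, map_smul, ← act_mul,
      mul_inv_cancel, act_one, inner_real_act_left, inner_real_act_left]

lemma isPlaneProjection_complexLine_base :
    IsPlaneProjection ComplexLine.base.1.starProjection !₂[0, 1] !₂[0, Complex.I] where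
  norm₀ := by simp [EuclideanSpace.norm_eq]
  norm₁ := by simp [EuclideanSpace.norm_eq]
  inner_eq := by simp [PiLp.inner_apply, Complex.inner]
  apply_eq x := by
    refine Submodule.eq_starProjection_of_mem_of_inner_eq_zero ?_ ?_
    · refine Submodule.mem_span_pair.mpr ⟨(x 0).re, (x 0).im, ?_⟩
      ext i
      fin_cases i <;> apply Complex.ext <;> simp [PiLp.inner_apply, Complex.inner]
    · intro y hy
      obtain ⟨s, t, rfl⟩ := Submodule.mem_span_pair.mp hy
      simp [PiLp.inner_apply, Complex.inner]

lemma isPlaneProjection_lagrangian_base :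
    IsPlaneProjection LagrangianPlane.base.1.starProjection !₂[Complex.I, 0] !₂[0, Complex.I] where
  norm₀ := by simp [EuclideanSpace.norm_eq]
  norm₁ := by simp [EuclideanSpace.norm_eq]
  inner_eq := by simp [PiLp.inner_apply, Complex.inner]
  apply_eq x := by
    refine Submodule.eq_starProjection_of_mem_of_inner_eq_zero ?_ ?_
    · refine Submodule.mem_span_pair.mpr ⟨(x 0).re, (x 1).re, ?_⟩
      ext i
      fin_cases i <;> apply Complex.ext <;> simp [PiLp.inner_apply, Complex.inner]
    · intro y hy
      obtain ⟨s, t, rfl⟩ := Submodule.mem_span_pair.mp hy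
      simp [PiLp.inner_apply, Complex.inner]

/-- The integrand of `planeIntegral` in a principal frame is a combination of kernels. -/
lemma IsPrincipalFrame.planeIntegrand_eq {p : C2 → C2} {x : C2}
    {b : OrthonormalBasis (Fin 4) ℝ C2} {q : Fin 4 → ℝ}
    (h : IsPrincipalFrame (fderiv ℝ p x) (x - p x) b q) (hn : x - p x ≠ 0) {P : C2 →L[ℝ] C2}
    {f₀ f₁ : C2} (hP : IsPlaneProjection P f₀ f₁) :
    projJacobian p P x * (‖x - p x‖ ^ 2 / ‖(x - p x) - P (x - p x)‖ ^ 2) =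
      (1 - q 1) * q 2 * q 3 * kernel f₀ f₁ (b 0) (b 1) +
        (1 - q 2) * q 1 * q 3 * kernel f₀ f₁ (b 0) (b 2) +
        (1 - q 3) * q 1 * q 2 * kernel f₀ f₁ (b 0) (b 3) := by
  have h1 : ‖x - p x‖ ^ 2 / ‖(x - p x) - P (x - p x)‖ ^ 2 =
      (inner ℝ f₀ (b 0) ^ 2 + inner ℝ f₁ (b 0) ^ 2)⁻¹ := by
    have hn0 : ‖x - p x‖ ^ 2 ≠ 0 := pow_ne_zero 2 (norm_ne_zero_iff.mpr hn)
    have h2 : ‖(x - p x) - P (x - p x)‖ ^ 2 =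
        ‖x - p x‖ ^ 2 * (inner ℝ f₀ (b 0) ^ 2 + inner ℝ f₁ (b 0) ^ 2) := by
      have e (f : C2) : inner ℝ f (x - p x) = ‖x - p x‖ * inner ℝ f (b 0) := by
        conv_lhs => rw [← h.smul_eq, real_inner_smul_right]
      rw [hP.norm_sub_sq, e, e]
      ring
    rw [h2, div_mul_cancel_left₀ hn0]
  rw [h1, h.projJacobian_eq hP]
  simp only [kernel, div_eq_mul_inv]
  ring

lemma measurable_shellIntegrand {V : Type*} [NormedAddCommGroup V] [InnerProductSpace ℝ V]
    [FiniteDimensional ℝ V] [MeasurableSpace V] [BorelSpace V] {p : V → V} (hp : Continuous p) :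
    Measurable fun z : (V →L[ℝ] V) × V => ENNReal.ofReal (projJacobian p z.1 z.2 *
      (‖z.2 - p z.2‖ ^ 2 / ‖(z.2 - p z.2) - z.1 (z.2 - p z.2)‖ ^ 2)) := by
  have hn : Measurable fun x => x - p x := measurable_id.sub hp.measurable
  have hdet : Continuous fun z : (V →L[ℝ] V) × (V →L[ℝ] V) =>
      (z.1 * z.2 + (1 - z.1) * (1 - z.2)).det :=
    ContinuousLinearMap.continuous_det.comp (by fun_prop)
  have h1 : Measurable fun z : (V →L[ℝ] V) × V => projJacobian p z.1 z.2 :=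
    hdet.measurable.comp (measurable_fst.prodMk ((measurable_fderiv ℝ p).comp measurable_snd))
  have hev : Continuous fun z : (V →L[ℝ] V) × V => ‖z.2 - z.1 z.2‖ ^ 2 := by fun_prop
  have h2 : Measurable fun z : (V →L[ℝ] V) × V =>
      ‖(z.2 - p z.2) - z.1 (z.2 - p z.2)‖ ^ 2 :=
    hev.measurable.comp (measurable_fst.prodMk (hn.comp measurable_snd))
  exact (h1.mul (((hn.comp measurable_snd).norm.pow_const 2).div h2)).ennreal_ofReal

lemma measurable_starProjection_map_act (B : Submodule ℝ C2) :
    Measurable fun g : U2 => ((B.map (act g)).starProjection : C2 →L[ℝ] C2) := by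
  let := grassmannTopology (V := C2)
  have h : Continuous fun F : Submodule ℝ C2 => (F.starProjection : C2 →L[ℝ] C2) :=
    continuous_induced_dom
  exact (h.comp (continuous_map_act B)).measurable

variable {K : Set C2} {p : C2 → C2} (hp : IsNearestPointMap K p)

include hp

lemma measurable_planeIntegrand : Measurable fun z : (C2 →L[ℝ] C2) × C2 =>
    ENNReal.ofReal (projJacobian p z.1 z.2 *
      (‖z.2 - p z.2‖ ^ 2 / ‖(z.2 - p z.2) - z.1 (z.2 - p z.2)‖ ^ 2)) :=
  measurable_shellIntegrand hp.lipschitzWith.continuous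

lemma measurable_planeIntegral : Measurable (planeIntegral K p) :=
  (measurable_planeIntegrand hp).lintegral_prod_right'

lemma lintegral_planeIntegral (B : Submodule ℝ C2) :
    ∫⁻ g, planeIntegral K p (B.map (act g)).starProjection ∂haarU2 =
      ∫⁻ x in Kᶜ ∩ {x | ‖x - p x‖ ≤ 1}, (∫⁻ g, ENNReal.ofReal
        (projJacobian p (B.map (act g)).starProjection x * (‖x - p x‖ ^ 2 /
          ‖(x - p x) - (B.map (act g)).starProjection (x - p x)‖ ^ 2)) ∂haarU2) :=
  lintegral_lintegral_swap ((measurable_planeIntegrand hp).comp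
    (((measurable_starProjection_map_act B).comp measurable_fst).prodMk
      measurable_snd)).aemeasurable

/-- The sum of the two averages is the integral of the second coefficient of the Jacobian of the
dilations of the normal bundle. -/
lemma lintegral_planeIntegral_add (hK : IsClosed K) :
    ∫⁻ g, planeIntegral K p (ComplexLine.base.1.map (act g)).starProjection ∂haarU2 +
      2 * ∫⁻ g, planeIntegral K p (LagrangianPlane.base.1.map (act g)).starProjection ∂haarU2 =
      shellIntegral K p 1 := by
  have hmeas (B : Submodule ℝ C2) : Measurable fun x => ∫⁻ g, ENNReal.ofReal
        (projJacobian p (B.map (act g)).starProjection x * (‖x - p x‖ ^ 2 /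
          ‖(x - p x) - (B.map (act g)).starProjection (x - p x)‖ ^ 2)) ∂haarU2 :=
    ((measurable_planeIntegrand hp).comp
      (((measurable_starProjection_map_act B).comp measurable_snd).prodMk
        measurable_fst)).lintegral_prod_right'
  rw [lintegral_planeIntegral hp, lintegral_planeIntegral hp,
    ← lintegral_const_mul' _ _ ENNReal.ofNat_ne_top, ← lintegral_add_left (hmeas _), shellIntegral]
  rw [Set.inter_comm, ← Measure.restrict_restrict (measurableSet_shell hp 1)]
  refine lintegral_congr_ae (ae_restrict_of_ae (hp.ae_compl hK fun x hx hd => ?_))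
  obtain ⟨b, q, hf⟩ := hp.exists_frame finrank_C2 hx hd
  have hn : x - p x ≠ 0 := fun h => hx (hp.mem_iff.mpr h)
  have h1 := hf.nonneg
  have h2 := fun i => sub_nonneg.mpr (hf.le_one i)
  have hk (f₀ f₁ : C2) (j : Fin 4) : Measurable fun g : U2 =>
      ENNReal.ofReal (kernel (act g f₀) (act g f₁) (b 0) (b j)) := by
    simp only [kernel_act]
    exact (measurable_kernel_act_inv _ _ _ _).ennreal_ofReal
  have hint {B : Submodule ℝ C2} {f₀ f₁ : C2} (hB : IsPlaneProjection B.starProjection f₀ f₁) :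
      ∫⁻ g, ENNReal.ofReal (projJacobian p (B.map (act g)).starProjection x * (‖x - p x‖ ^ 2 /
          ‖(x - p x) - (B.map (act g)).starProjection (x - p x)‖ ^ 2)) ∂haarU2 =
      ENNReal.ofReal ((1 - q 1) * q 2 * q 3) *
        ∫⁻ g, ENNReal.ofReal (kernel (act g f₀) (act g f₁) (b 0) (b 1)) ∂haarU2 +
      ENNReal.ofReal ((1 - q 2) * q 1 * q 3) *
        ∫⁻ g, ENNReal.ofReal (kernel (act g f₀) (act g f₁) (b 0) (b 2)) ∂haarU2 +
      ENNReal.ofReal ((1 - q 3) * q 1 * q 2) *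
        ∫⁻ g, ENNReal.ofReal (kernel (act g f₀) (act g f₁) (b 0) (b 3)) ∂haarU2 := by
    rw [← lintegral_const_mul _ (hk _ _ _), ← lintegral_const_mul _ (hk _ _ _),
      ← lintegral_const_mul _ (hk _ _ _), ← lintegral_add_left ((hk _ _ _).const_mul _),
      ← lintegral_add_right _ ((hk _ _ _).const_mul _)]
    refine lintegral_congr fun g => ?_
    have e1 := mul_nonneg (mul_nonneg (h2 1) (h1 2)) (h1 3)
    have e2 := mul_nonneg (mul_nonneg (h2 2) (h1 1)) (h1 3)
    have e3 := mul_nonneg (mul_nonneg (h2 3) (h1 1)) (h1 2)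
    have k (j : Fin 4) := kernel_nonneg (act g f₀) (act g f₁) (b 0) (b j)
    rw [hf.planeIntegrand_eq hn (hB.map_act g), ENNReal.ofReal_add
      (add_nonneg (mul_nonneg e1 (k 1)) (mul_nonneg e2 (k 2))) (mul_nonneg e3 (k 3)),
      ENNReal.ofReal_add (mul_nonneg e1 (k 1)) (mul_nonneg e2 (k 2)), ENNReal.ofReal_mul e1,
      ENNReal.ofReal_mul e2, ENNReal.ofReal_mul e3]
  have hone (j : Fin 4) (hj : 0 ≠ j) := lintegral_kernel_add (n := b 0) (m := b j)
    (b.orthonormal.1 0) (b.orthonormal.1 j) (b.orthonormal.2 hj)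
  have g1 := hone 1 (by decide)
  have g2 := hone 2 (by decide)
  have g3 := hone 3 (by decide)
  beta_reduce
  rw [hint isPlaneProjection_complexLine_base, hint isPlaneProjection_lagrangian_base,
    hf.dilationCoeff_eq]
  simp only [Matrix.cons_val_one, Matrix.cons_val_zero]
  rw [faceDensity, ENNReal.ofReal_add (add_nonneg (mul_nonneg (mul_nonneg (h2 1) (h1 2)) (h1 3))
    (mul_nonneg (mul_nonneg (h2 2) (h1 1)) (h1 3))) (mul_nonneg (mul_nonneg (h2 3) (h1 1)) (h1 2)),
    ENNReal.ofReal_add (mul_nonneg (mul_nonneg (h2 1) (h1 2)) (h1 3))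
    (mul_nonneg (mul_nonneg (h2 2) (h1 1)) (h1 3))]
  conv_rhs => rw [← mul_one (ENNReal.ofReal ((1 - q 1) * q 2 * q 3)), ← g1,
    ← mul_one (ENNReal.ofReal ((1 - q 2) * q 1 * q 3)), ← g2,
    ← mul_one (ENNReal.ofReal ((1 - q 3) * q 1 * q 2)), ← g3]
  ring

end PlaneIntegral

/-! ### The averages of the projected areas -/

section Averages

lemma continuous_starProjection_complexLine :
    Continuous fun F : ComplexLine => (F.1.starProjection : C2 →L[ℝ] C2) := by
  let := grassmannTopology (V := C2)
  have h : Continuous fun F : Submodule ℝ C2 => (F.starProjection : C2 →L[ℝ] C2) :=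
    continuous_induced_dom
  exact h.comp continuous_induced_dom

lemma continuous_starProjection_lagrangianPlane :
    Continuous fun F : LagrangianPlane => (F.1.starProjection : C2 →L[ℝ] C2) := by
  let := grassmannTopology (V := C2)
  have h : Continuous fun F : Submodule ℝ C2 => (F.starProjection : C2 →L[ℝ] C2) :=
    continuous_induced_dom
  exact h.comp continuous_induced_dom

lemma isSteinerSequence_empty : IsSteinerSequence (∅ : Set C2) fun _ => 0 :=
  ⟨fun _ _ => rfl, fun ε _ => by simp⟩

variable {K : Set C2} {p : C2 → C2}

/-- The projected area as an integral over the shell around `K`. -/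
lemma IsNearestPointMap.ofReal_projectionArea (hp : IsNearestPointMap K p) (hK : IsCompact K)
    (hconv : Convex ℝ K) {E : Submodule ℝ C2} (hE : Module.finrank ℝ E = 2) {f₀ f₁ : C2}
    (hP : IsPlaneProjection E.starProjection f₀ f₁) :
    ENNReal.ofReal (projectionArea K E) =
      planeIntegral K p E.starProjection / ENNReal.ofReal (unitBallVolume 2) := by
  have hfin : volume (E.orthogonalProjectionOnto '' K) ≠ ⊤ :=
    (hK.image E.orthogonalProjectionOnto.continuous).measure_lt_top.ne
  have hpos := unitBallVolume_pos 2
  rw [projectionArea, ofReal_measureReal hfin, planeIntegral,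
    hp.lintegral_shell_projJacobian hK hconv finrank_C2 hE hP,
    ENNReal.mul_div_cancel_right (by simpa using hpos) ENNReal.ofReal_ne_top]

lemma IsNearestPointMap.ofReal_projectionArea_complexLine (hp : IsNearestPointMap K p)
    (hK : IsCompact K) (hconv : Convex ℝ K) (F : ComplexLine) :
    ENNReal.ofReal (projectionArea K F.1) =
      planeIntegral K p F.1.starProjection / ENNReal.ofReal (unitBallVolume 2) := by
  obtain ⟨g, rfl⟩ := F.exists_move_base
  exact hp.ofReal_projectionArea hK hconv (ComplexLine.base.move g).2.1
    (isPlaneProjection_complexLine_base.map_act g)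

lemma IsNearestPointMap.ofReal_projectionArea_lagrangianPlane (hp : IsNearestPointMap K p)
    (hK : IsCompact K) (hconv : Convex ℝ K) (F : LagrangianPlane) :
    ENNReal.ofReal (projectionArea K F.1) =
      planeIntegral K p F.1.starProjection / ENNReal.ofReal (unitBallVolume 2) := by
  obtain ⟨g, rfl⟩ := F.exists_move_base
  exact hp.ofReal_projectionArea hK hconv (LagrangianPlane.base.move g).2.1
    (isPlaneProjection_lagrangian_base.map_act g)

lemma projectionArea_nonneg (K : Set C2) (F : Submodule ℝ C2) : 0 ≤ projectionArea K F :=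
  measureReal_nonneg

lemma measurable_of_measurable_ofReal {α : Type*} [MeasurableSpace α] {f : α → ℝ}
    (h0 : ∀ x, 0 ≤ f x) (h : Measurable fun x => ENNReal.ofReal (f x)) : Measurable f := by
  have h1 := h.ennreal_toReal
  simpa only [ENNReal.toReal_ofReal (h0 _)] using h1

lemma IsNearestPointMap.measurable_projectionArea_complexLine (hp : IsNearestPointMap K p)
    (hK : IsCompact K) (hconv : Convex ℝ K) :
    Measurable fun F : ComplexLine => projectionArea K F.1 := by
  refine measurable_of_measurable_ofReal (fun F => projectionArea_nonneg K F.1) ?_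
  simp only [hp.ofReal_projectionArea_complexLine hK hconv]
  exact ((measurable_planeIntegral hp).comp
    continuous_starProjection_complexLine.measurable).div_const _

lemma IsNearestPointMap.measurable_projectionArea_lagrangianPlane (hp : IsNearestPointMap K p)
    (hK : IsCompact K) (hconv : Convex ℝ K) :
    Measurable fun F : LagrangianPlane => projectionArea K F.1 := by
  refine measurable_of_measurable_ofReal (fun F => projectionArea_nonneg K F.1) ?_
  simp only [hp.ofReal_projectionArea_lagrangianPlane hK hconv]
  exact ((measurable_planeIntegral hp).comp
    continuous_starProjection_lagrangianPlane.measurable).div_const _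

/-- The identity behind the theorem, with values in `[0, ∞]`; the finiteness of the averages is not
needed here but follows from it. -/
lemma IsNearestPointMap.lintegral_projectionArea_add (hp : IsNearestPointMap K p)
    (hK : IsCompact K) (hconv : Convex ℝ K) :
    ∫⁻ F : ComplexLine, ENNReal.ofReal (projectionArea K F.1) ∂haarComplexLine +
      2 * ∫⁻ F : LagrangianPlane, ENNReal.ofReal (projectionArea K F.1) ∂haarLagrangian =
      shellIntegral K p 1 / ENNReal.ofReal (unitBallVolume 2) := by
  have hm := measurable_planeIntegral hp
  have hc : ENNReal.ofReal (unitBallVolume 2) ≠ 0 := by simpa using unitBallVolume_pos 2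
  simp only [hp.ofReal_projectionArea_complexLine hK hconv,
    hp.ofReal_projectionArea_lagrangianPlane hK hconv]
  have h1 : Measurable fun F : ComplexLine =>
      planeIntegral K p F.1.starProjection / ENNReal.ofReal (unitBallVolume 2) :=
    (hm.comp continuous_starProjection_complexLine.measurable).div_const _
  have h2 : Measurable fun F : LagrangianPlane =>
      planeIntegral K p F.1.starProjection / ENNReal.ofReal (unitBallVolume 2) :=
    (hm.comp continuous_starProjection_lagrangianPlane.measurable).div_const _
  have e1 := lintegral_map (μ := haarU2) h1
    (ComplexLine.continuous_move ComplexLine.base).measurable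
  have e2 := lintegral_map (μ := haarU2) h2
    (LagrangianPlane.continuous_move LagrangianPlane.base).measurable
  rw [haarComplexLine, haarLagrangian, e1, e2]
  simp only [div_eq_mul_inv]
  rw [lintegral_mul_const' _ _ (ENNReal.inv_ne_top.mpr hc),
    lintegral_mul_const' _ _ (ENNReal.inv_ne_top.mpr hc),
    ← lintegral_planeIntegral_add hp hK.isClosed, add_mul, mul_assoc]
  rfl

/-- The theorem for a nonempty convex compact set. -/
lemma IsNearestPointMap.average_eq (hp : IsNearestPointMap K p) (hK : IsCompact K)
    (hconv : Convex ℝ K) :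
    (∃ v, IsSteinerSequence K v) ∧
    Integrable (fun F : ComplexLine => projectionArea K F.1) haarComplexLine ∧
    Integrable (fun F : LagrangianPlane => projectionArea K F.1) haarLagrangian ∧
    complexAverage K + 2 * lagrangianAverage K = intrinsicVolume 2 K := by
  obtain ⟨v, hv, hv2⟩ := hp.exists_isSteinerSequence hK finrank_C2
  have hpos := unitBallVolume_pos 2
  have hadd := hp.lintegral_projectionArea_add hK hconv
  have hfin : shellIntegral K p 1 / ENNReal.ofReal (unitBallVolume 2) ≠ ⊤ :=
    ENNReal.div_ne_top (hp.shellIntegral_ne_top hK finrank_C2 1) (by simpa using hpos)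
  have hfin' := hadd ▸ hfin
  have hfC := (ENNReal.add_ne_top.mp hfin').1
  have hfL := ENNReal.lt_top_of_mul_ne_top_right (ENNReal.add_ne_top.mp hfin').2 two_ne_zero |>.ne
  have hmC := (hp.measurable_projectionArea_complexLine hK hconv).aestronglyMeasurable
    (μ := haarComplexLine)
  have hmL := (hp.measurable_projectionArea_lagrangianPlane hK hconv).aestronglyMeasurable
    (μ := haarLagrangian)
  have h0C := Filter.Eventually.of_forall (f := ae haarComplexLine)
    fun F : ComplexLine => projectionArea_nonneg K F.1
  have h0L := Filter.Eventually.of_forall (f := ae haarLagrangian)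
    fun F : LagrangianPlane => projectionArea_nonneg K F.1
  refine ⟨⟨v, hv⟩, (lintegral_ofReal_ne_top_iff_integrable hmC h0C).mp hfC,
    (lintegral_ofReal_ne_top_iff_integrable hmL h0L).mp hfL, ?_⟩
  rw [hv.intrinsicVolume_two_eq finrank_C2, complexAverage, lagrangianAverage,
    integral_eq_lintegral_of_nonneg_ae h0C hmC, integral_eq_lintegral_of_nonneg_ae h0L hmL,
    ← ENNReal.toReal_ofNat 2, ← ENNReal.toReal_mul,
    ← ENNReal.toReal_add hfC (ENNReal.add_ne_top.mp hfin').2, hadd, ENNReal.toReal_div,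
    ENNReal.toReal_ofReal hpos.le, ← hv2, mul_div_cancel_left₀ _ hpos.ne']

end Averages

end HermitianPlane

end

theorem theorem3p2p4 (K : Set HermitianPlane.C2) (hK : IsCompact K) (hconv : Convex ℝ K) :
    (∃ v : ℕ → ℝ, HermitianPlane.IsSteinerSequence K v) ∧
    Integrable (fun F : HermitianPlane.ComplexLine => HermitianPlane.projectionArea K F.1)
      HermitianPlane.haarComplexLine ∧
    Integrable (fun F : HermitianPlane.LagrangianPlane => HermitianPlane.projectionArea K F.1)
      HermitianPlane.haarLagrangian ∧
    HermitianPlane.complexAverage K + 2 * HermitianPlane.lagrangianAverage K =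
      HermitianPlane.intrinsicVolume 2 K := by
  rcases K.eq_empty_or_nonempty with rfl | hne
  · have h0 (F : Submodule ℝ HermitianPlane.C2) :
        HermitianPlane.projectionArea (∅ : Set HermitianPlane.C2) F = 0 := by
      simp [HermitianPlane.projectionArea]
    refine ⟨⟨_, HermitianPlane.isSteinerSequence_empty⟩, ?_, ?_, ?_⟩
    · simp only [h0]
      exact integrable_zero _ _ _
    · simp only [h0]
      exact integrable_zero _ _ _
    · rw [HermitianPlane.isSteinerSequence_empty.intrinsicVolume_two_eq HermitianPlane.finrank_C2]
      simp [HermitianPlane.complexAverage, HermitianPlane.lagrangianAverage, h0]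
  · obtain ⟨p, hp⟩ := HermitianPlane.exists_isNearestPointMap hK hconv hne
    exact hp.average_eq hK hconv
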